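/- Let $K$ be a field that is complete for an ultrametric absolute value $|\cdot|$, with infinite residue field, and whose value group $|K^*|$ is not discrete (equivalently, is dense in $\mathbb{R}_{>0}$). **Balls of $K$ and $\mathbb{P}^1_K$.** For $a\in K$ and $r\in|K^*|$, the sets $\{|z-a|<r\}$ and $\{|z-a|\le r\}$ are an open and a closed ball of $K$; for $r>0$, $r\notin|K^*|$, they coincide and form an irrational ball of $K$. Identify $K$ with $\mathbb{P}^1_K\setminus\{\infty\}$. An open (resp. closed, irrational) ball of $\mathbb{P}^1_K$ is a ball of $K$ of the same kind or the complement in $\mathbb{P}^1_K$ of a closed (resp. open, irrational) ball of $K$. An open affinoid is a finite intersection of open balls of $\mathbb{P}^1_K$ (the empty intersection being $\mathbb{P}^1_K$). **The compactification $\mathbb{A}^1_K$.** Give $\mathbb{P}^1_K$ the uniform structure whose entourages are the sets containing $\bigcup_{Y\in C}Y\times Y$ for some finite covering $C$ of $\mathbb{P}^1_K$ by open affinoids. Let $\mathbb{A}^1_K$ be its Hausdorff completion, i.e. the set of minimal Cauchy filters on $\mathbb{P}^1_K$ with its uniform structure; a point $x\in\mathbb{P}^1_K$ is identified with its filter of neighbourhoods.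 For $\mathcal{F}\in\mathbb{A}^1_K$ let $B_{\mathcal F}$ be the intersection of all balls of $K$ (open, closed or irrational) that belong to $\mathcal F$. The open balls of $\mathbb{A}^1_K$ are the sets $\widehat B=\{\mathcal F : B\in\mathcal F\}$ for $B$ an open or irrational ball of $\mathbb{P}^1_K$; the closed balls of $\mathbb{A}^1_K$ are the closures $\overline B$ in $\mathbb{A}^1_K$ of the closed or irrational balls $B$ of $\mathbb{P}^1_K$. **The tree.** Let $A_K^{\mathbb R}$ be the quotient of $K\times[0,\infty)$ by $(x,r)\sim(x',r')\iff r=r'\ge|x-x'|$, and write $[x,r]$ for the class of $(x,r)$. Put $B_{[x,r]}=\{w\in K:|w-x|\le r\}$, $\operatorname{diam}[x,r]=r$, $|[x,r]|=\max\{|x|,r\}$, $\sup\{[x,r],[x',r']\}=\max\{r,r',|x-x'|\}$ and $\delta(S,S')=\sup\{S,S'\}-\tfrac12(\operatorname{diam}S+\operatorname{diam}S')$. Then $\delta$ is a distance; identify $x\in K$ with $[x,0]$. Let $A_K$ be the completion of $(A_K^{\mathbb R},\delta)$, to which $\operatorname{diam}$, $|\cdot|$ and $\sup$ extend by continuity.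 With $h(S)=\max\{1,|S|\}$, put $\widehat A_K=A_K\sqcup\{\infty\}$ with the distance $$\Delta(S,S')=\frac{\sup\{S,S'\}}{h(S)h(S')}-\frac{\operatorname{diam}S}{2h(S)^2}-\frac{\operatorname{diam}S'}{2h(S')^2},\qquad \Delta(S,\infty)=\frac1{h(S)}-\frac{\operatorname{diam}S}{2h(S)^2}\qquad(S,S'\in A_K).$$ The open (resp. closed) balls of $A_K$ are the sets $\{S:\sup\{x,S\}<r\}$ (resp. $\le r$) with $x\in K$, $r>0$; an open (resp. closed) ball of $\widehat A_K$ is an open (resp. closed) ball of $A_K$ or the complement in $\widehat A_K$ of a closed (resp. open) ball of $A_K$. Identify $\mathbb{P}^1_K$ with $K\sqcup\{\infty\}\subset\widehat A_K$. **Theorem.** For each $S\in A_K^{\mathbb R}\setminus K$ there is a unique $\iota(S)\in\mathbb{A}^1_K$ such that $B_{\iota(S)}=B_S$, and the following hold. 1. The map $\iota:A_K^{\mathbb R}\setminus K\to\mathbb{A}^1_K$ extends to a uniformly continuous bijection, again denoted $\iota$, from $(\widehat A_K,\Delta)$ onto the uniform space $\mathbb{A}^1_K$. 2. The map $D\mapsto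 D\cap\mathbb{P}^1_K$ is a bijection from the open (resp. closed) balls of $\widehat A_K$ onto the open or irrational (resp. closed or irrational) balls of $\mathbb{P}^1_K$. For an open (resp. closed) ball $D$ of $\widehat A_K$ and the corresponding ball $B=D\cap\mathbb{P}^1_K$, one has $\iota(D)=\widehat B$ (resp. $\iota(D)=\overline B$). In particular $\iota$ carries the open (resp. closed) balls of $\widehat A_K$ exactly onto the open (resp. closed) balls of $\mathbb{A}^1_K$. -/

import Mathlib

open Set Filter Topology Uniformity
open scoped NNReal

noncomputable section

namespace BerkLine

/-! ### Balls and open affinoids of the projective line -/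

section Balls

variable (K : Type*) [NormedField K]

/-- The value group `|K^*|`, as a set of positive real numbers. -/
def valueGroup : Set ℝ := {r | ∃ z : K, z ≠ 0 ∧ ‖z‖ = r}

/-- The projective line of `K`: the lines through the origin of `K × K`. -/
def P1 : Type _ := Projectivization K (K × K)

variable {K}

/-- The point `[z : 1]`. -/
def P1.of (z : K) : P1 K :=
  Projectivization.mk K (z, (1 : K)) (fun h => one_ne_zero (congrArg Prod.snd h))

variable (K) in
/-- The point at infinity `[1 : 0]`. -/
def P1.infty : P1 K :=
  Projectivization.mk K ((1 : K), (0 : K)) (fun h => one_ne_zero (congrArg Prod.fst h))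

theorem P1.of_injective : Function.Injective (P1.of : K → P1 K) := by
  intro x y h
  obtain ⟨a, ha⟩ := (Projectivization.mk_eq_mk_iff' K _ _ _ _).1 h
  simp only [Prod.smul_mk, smul_eq_mul, mul_one, Prod.mk.injEq] at ha
  obtain ⟨h1, h2⟩ := ha
  rw [← h1, h2, one_mul]

theorem P1.of_ne_infty (x : K) : P1.of x ≠ P1.infty K := by
  intro h
  obtain ⟨a, ha⟩ := (Projectivization.mk_eq_mk_iff' K _ _ _ _).1 h
  simp at ha

theorem P1.eq_infty_or_of (p : P1 K) : p = P1.infty K ∨ ∃ x : K, p = P1.of x := by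
  induction p using Projectivization.ind with
  | h v hv =>
    obtain ⟨x, y⟩ := v
    by_cases hy : y = 0
    · left
      subst hy
      refine (Projectivization.mk_eq_mk_iff' K _ _ _ _).2 ⟨x, by simp⟩
    · right
      refine ⟨x / y, (Projectivization.mk_eq_mk_iff' K _ _ _ _).2 ⟨y, ?_⟩⟩
      simp only [Prod.smul_mk, smul_eq_mul, mul_one, Prod.mk.injEq, and_true]
      field_simp

/-- Open balls of `K`: the radius belongs to the value group. -/
def IsOpenBallK (B : Set K) : Prop :=
  ∃ a : K, ∃ r ∈ valueGroup K, B = {z | ‖z - a‖ < r}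

/-- Closed balls of `K`: the radius belongs to the value group. -/
def IsClosedBallK (B : Set K) : Prop :=
  ∃ a : K, ∃ r ∈ valueGroup K, B = {z | ‖z - a‖ ≤ r}

/-- Irrational balls of `K`: the radius is positive and not in the value group (so that a
strict or a large inequality define the same set). -/
def IsIrrationalBallK (B : Set K) : Prop :=
  ∃ a : K, ∃ r : ℝ, 0 < r ∧ r ∉ valueGroup K ∧ B = {z | ‖z - a‖ ≤ r}

/-- Balls of `K`, of any of the three kinds. -/
def IsBallK (B : Set K) : Prop := IsOpenBallK B ∨ IsClosedBallK B ∨ IsIrrationalBallK B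

/-- Open balls of the projective line. -/
def IsOpenBall (D : Set (P1 K)) : Prop :=
  (∃ B : Set K, IsOpenBallK B ∧ D = P1.of '' B) ∨
    ∃ B : Set K, IsClosedBallK B ∧ D = (P1.of '' B)ᶜ

/-- Closed balls of the projective line. -/
def IsClosedBall (D : Set (P1 K)) : Prop :=
  (∃ B : Set K, IsClosedBallK B ∧ D = P1.of '' B) ∨
    ∃ B : Set K, IsOpenBallK B ∧ D = (P1.of '' B)ᶜ

/-- Irrational balls of the projective line. -/
def IsIrrationalBall (D : Set (P1 K)) : Prop :=
  (∃ B : Set K, IsIrrationalBallK B ∧ D = P1.of '' B) ∨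
    ∃ B : Set K, IsIrrationalBallK B ∧ D = (P1.of '' B)ᶜ

/-- Open affinoids: finite intersections of open balls (the empty intersection being the
whole projective line). -/
def IsOpenAffinoid (Y : Set (P1 K)) : Prop :=
  ∃ s : Set (Set (P1 K)), s.Finite ∧ (∀ D ∈ s, IsOpenBall D) ∧ Y = ⋂₀ s

/-- Finite coverings of the projective line by open affinoids. -/
def IsAffinoidCover (C : Set (Set (P1 K))) : Prop :=
  C.Finite ∧ (∀ Y ∈ C, IsOpenAffinoid Y) ∧ ⋃₀ C = univ

/-- The set `V(C)`, the union of the `Y × Y` for `Y` in `C`. -/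
def coverRel (C : Set (Set (P1 K))) : Set (P1 K × P1 K) := ⋃ Y ∈ C, Y ×ˢ Y

end Balls

/-! ### The uniform structure of finite coverings by open affinoids -/

/-- The residue field of `K`. -/
abbrev ResField (K : Type*) [NormedField K] [IsUltrametricDist K] : Type _ :=
  IsLocalRing.ResidueField (NormedField.valuation (K := K)).valuationSubring

section Uniform

variable {K : Type*} [NormedField K]

theorem isOpenAffinoid_sInter {s : Set (Set (P1 K))} (hs : s.Finite)
    (h : ∀ Y ∈ s, IsOpenAffinoid Y) : IsOpenAffinoid (⋂₀ s) := by
  classical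
  choose! t ht hb he using h
  refine ⟨⋃ Y ∈ s, t Y, hs.biUnion ht, ?_, ?_⟩
  · intro D hD
    obtain ⟨Y, hY, hD⟩ := mem_iUnion₂.1 hD
    exact hb Y hY D hD
  · ext x
    simp only [mem_sInter, mem_iUnion, exists_prop, forall_exists_index, and_imp]
    constructor
    · intro h D Y hY hD
      have := h Y hY
      rw [he Y hY] at this
      exact this D hD
    · intro h Y hY
      rw [he Y hY]
      exact fun D hD => h D Y hY hD

theorem IsOpenBall.isOpenAffinoid {D : Set (P1 K)} (h : IsOpenBall D) : IsOpenAffinoid D :=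
  ⟨{D}, finite_singleton D, by simpa using h, by simp⟩

theorem of_mem_image {B : Set K} {z : K} : P1.of z ∈ P1.of '' B ↔ z ∈ B :=
  P1.of_injective.mem_set_image

theorem infty_notMem_image {B : Set K} : P1.infty K ∉ P1.of '' B := by
  rintro ⟨x, -, hx⟩
  exact P1.of_ne_infty x hx

variable [IsUltrametricDist K]

theorem norm_sub_le_max' (x y z : K) : ‖x - z‖ ≤ max ‖x - y‖ ‖y - z‖ := by
  have := IsUltrametricDist.norm_add_le_max (x - y) (y - z)
  rwa [sub_add_sub_cancel] at this

/-- Representatives of the residue classes, at mutual distance one. -/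
theorem exists_residue_family :
    ∃ t : ResField K → K, (∀ i, ‖t i‖ ≤ 1) ∧ ∀ i j, i ≠ j → ‖t i - t j‖ = 1 := by
  let A := (NormedField.valuation (K := K)).valuationSubring
  have hsurj : Function.Surjective (IsLocalRing.residue A) := IsLocalRing.residue_surjective
  choose t ht using hsurj
  have hle : ∀ a : A, ‖(a : K)‖ ≤ 1 := by
    intro a
    have := (Valuation.mem_valuationSubring_iff _ _).1 a.2
    simpa [← NNReal.coe_le_coe] using this
  refine ⟨fun i => (t i : K), fun i => hle _, ?_⟩
  intro i j hij
  have hu : IsUnit (t i - t j) := by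
    by_contra hu
    have hm : t i - t j ∈ IsLocalRing.maximalIdeal A := hu
    have := (IsLocalRing.residue_eq_zero_iff _).2 hm
    rw [map_sub, ht, ht, sub_eq_zero] at this
    exact hij this
  obtain ⟨u, hu⟩ := hu
  have h1 : ‖((t i - t j : A) : K)‖ ≤ 1 := hle _
  have h2 : ‖((↑u⁻¹ : A) : K)‖ ≤ 1 := hle _
  have h3 : ((t i - t j : A) : K) * ((↑u⁻¹ : A) : K) = 1 := by
    rw [← hu]
    exact congrArg Subtype.val (u.mul_inv)
  have h4 : ‖((t i - t j : A) : K)‖ * ‖((↑u⁻¹ : A) : K)‖ = 1 := by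
    rw [← norm_mul, h3, norm_one]
  have h5 : ((t i - t j : A) : K) = (t i : K) - (t j : K) := rfl
  rw [h5] at h1 h4
  refine le_antisymm h1 ?_
  nlinarith [norm_nonneg ((t i : K) - (t j : K))]

/-- A finite covering of the projective line by open balls contains two balls that already
cover it. -/
theorem exists_pair_cover [Infinite (ResField K)] {S : Set (Set (P1 K))} (hS : S.Finite)
    (hb : ∀ D ∈ S, IsOpenBall D) (hc : ⋃₀ S = univ) :
    ∃ D ∈ S, ∃ D' ∈ S, D ∪ D' = univ := by
  by_contra hno
  push Not at hno
  have hT : {p : K × ℝ | p.2 ∈ valueGroup K ∧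
      (P1.of '' {z : K | ‖z - p.1‖ ≤ p.2})ᶜ ∈ S}.Nonempty := by
    have : P1.infty K ∈ ⋃₀ S := hc ▸ mem_univ _
    obtain ⟨D, hD, hi⟩ := this
    rcases hb D hD with ⟨B, -, rfl⟩ | ⟨B, ⟨a, r, hr, rfl⟩, rfl⟩
    · exact absurd hi infty_notMem_image
    · exact ⟨(a, r), hr, hD⟩
  let f : Set (P1 K) → ℝ := fun D => sInf {r : ℝ | r ∈ valueGroup K ∧
    ∃ a : K, D = (P1.of '' {z : K | ‖z - a‖ ≤ r})ᶜ}
  -- radii of closed balls are determined by the balls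
  have key : ∀ a a' : K, ∀ r ∈ valueGroup K, ∀ r' ∈ valueGroup K,
      (P1.of '' {z : K | ‖z - a‖ ≤ r})ᶜ = (P1.of '' {z : K | ‖z - a'‖ ≤ r'})ᶜ → r' ≤ r := by
    intro a a' r hr r' hr' h
    have h := P1.of_injective.image_injective (compl_injective h)
    obtain ⟨c, hc0, rfl⟩ := hr'
    have h1 : a' ∈ {z : K | ‖z - a‖ ≤ r} := by rw [h]; simp
    have h2 : a' + c ∈ {z : K | ‖z - a‖ ≤ r} := by rw [h]; simp
    have h3 := norm_sub_le_max' (a' + c) a a'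
    rw [add_sub_cancel_left, norm_sub_rev a a'] at h3
    exact h3.trans (max_le h2 h1)
  have hfin : {p : ℝ | p ∈ valueGroup K ∧ ∃ a : K,
      (P1.of '' {z : K | ‖z - a‖ ≤ p})ᶜ ∈ S}.Finite := by
    refine Set.Finite.subset (hS.image f) ?_
    rintro r ⟨hr, a, ha⟩
    refine ⟨_, ha, ?_⟩
    have : {r' : ℝ | r' ∈ valueGroup K ∧
        ∃ a' : K, (P1.of '' {z : K | ‖z - a‖ ≤ r})ᶜ =
          (P1.of '' {z : K | ‖z - a'‖ ≤ r'})ᶜ} = {r} := by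
      ext r'
      simp only [mem_ofPred_eq, mem_singleton_iff]
      constructor
      · rintro ⟨hr', a', h⟩
        exact le_antisymm (key _ _ _ hr _ hr' h) (key _ _ _ hr' _ hr h.symm)
      · rintro rfl
        exact ⟨hr, a, rfl⟩
    show sInf _ = r
    rw [this, csInf_singleton]
  obtain ⟨⟨a₀, r₀⟩, hr₀, ha₀⟩ := hT
  obtain ⟨r, ⟨hr, a, ha⟩, hmin⟩ := hfin.exists_minimal ⟨r₀, hr₀, a₀, ha₀⟩
  obtain ⟨t, ht1, ht2⟩ := exists_residue_family (K := K)
  obtain ⟨c, hc0, rfl⟩ := hr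
  have hcpos : 0 < ‖c‖ := norm_pos_iff.2 hc0
  have hcov : ∀ i, ∃ D ∈ S, P1.of (a + c * t i) ∈ D := by
    intro i
    have : P1.of (a + c * t i) ∈ ⋃₀ S := hc ▸ mem_univ _
    exact this
  choose D hD hmem using hcov
  have := hS.to_subtype
  obtain ⟨i, j, hij, hDij⟩ := Finite.exists_ne_map_eq_of_infinite (fun i => (⟨D i, hD i⟩ : S))
  have hDij : D i = D j := congrArg Subtype.val hDij
  have hin : ∀ i, ‖(a + c * t i) - a‖ ≤ ‖c‖ := by
    intro i
    rw [add_sub_cancel_left, norm_mul]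
    nlinarith [ht1 i]
  rcases hb _ (hD i) with ⟨B, ⟨b, s, hs, rfl⟩, hB⟩ | ⟨B, ⟨b, s, hs, rfl⟩, hB⟩
  · have hi := hmem i
    have hj := hmem j
    rw [← hDij] at hj
    rw [hB, of_mem_image] at hi hj
    have hi : ‖a + c * t i - b‖ < s := hi
    have hj : ‖a + c * t j - b‖ < s := hj
    have hcs : ‖c‖ < s := by
      have h1 := norm_sub_le_max' (a + c * t i) b (a + c * t j)
      rw [norm_sub_rev b] at h1
      have h2 : a + c * t i - (a + c * t j) = c * (t i - t j) := by ring
      rw [h2, norm_mul, ht2 i j hij, mul_one] at h1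
      exact h1.trans_lt (max_lt hi hj)
    refine hno _ ha _ (hD i) ?_
    rw [hB]
    refine eq_univ_of_forall fun p => ?_
    by_cases hp : p ∈ P1.of '' {z : K | ‖z - a‖ ≤ ‖c‖}
    · right
      obtain ⟨z, hz, rfl⟩ := hp
      rw [of_mem_image]
      have hz : ‖z - a‖ ≤ ‖c‖ := hz
      have h1 := norm_sub_le_max' z a b
      have h2 := norm_sub_le_max' a (a + c * t i) b
      rw [norm_sub_rev a (a + c * t i)] at h2
      exact h1.trans_lt (max_lt (hz.trans_lt hcs)
        (h2.trans_lt (max_lt ((hin i).trans_lt hcs) hi)))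
    · exact Or.inl hp
  · have hi := hmem i
    rw [hB, mem_compl_iff, of_mem_image] at hi
    have hi : ¬ ‖a + c * t i - b‖ ≤ s := hi
    have hDi := hD i
    rw [hB] at hDi
    have hle : ‖c‖ ≤ s := by
      by_contra hlt
      push Not at hlt
      exact absurd (hmin ⟨hs, b, hDi⟩ hlt.le) (not_le.2 hlt)
    refine hno _ ha _ hDi ?_
    refine eq_univ_of_forall fun p => ?_
    by_cases hp : p ∈ P1.of '' {z : K | ‖z - a‖ ≤ ‖c‖}
    · right
      obtain ⟨z, hz, rfl⟩ := hp
      rw [mem_compl_iff, of_mem_image]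
      intro hz'
      have hz : ‖z - a‖ ≤ ‖c‖ := hz
      have hz' : ‖z - b‖ ≤ s := hz'
      have h1 := norm_sub_le_max' (a + c * t i) a b
      have h2 := norm_sub_le_max' a z b
      rw [norm_sub_rev a z] at h2
      exact hi (h1.trans (max_le ((hin i).trans hle)
        (h2.trans (max_le (hz.trans hle) hz'))))
    · exact Or.inl hp

end Uniform

section Uniform2

variable {K : Type*} [DenselyNormedField K] [IsUltrametricDist K]

theorem separate_aux {a b : K} {r s : ℝ} (hr : r ∈ valueGroup K)
    (h : (P1.of '' {z : K | ‖z - a‖ ≤ r})ᶜ ∪ P1.of '' {z : K | ‖z - b‖ < s} = univ) :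
    ∃ E E' : Set (P1 K), IsOpenBall E ∧ IsOpenBall E' ∧
      ((P1.of '' {z : K | ‖z - a‖ ≤ r})ᶜ)ᶜ ⊆ E ∧ (P1.of '' {z : K | ‖z - b‖ < s})ᶜ ⊆ E' ∧
      Disjoint E E' := by
  have hsub : ∀ z : K, ‖z - a‖ ≤ r → ‖z - b‖ < s := by
    intro z hz
    have : P1.of z ∈ (P1.of '' {z : K | ‖z - a‖ ≤ r})ᶜ ∪ P1.of '' {z : K | ‖z - b‖ < s} :=
      h ▸ mem_univ _
    rcases this with h1 | h1
    · exact absurd ((of_mem_image (B := {z : K | ‖z - a‖ ≤ r})).2 hz) h1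
    · exact (of_mem_image (B := {z : K | ‖z - b‖ < s})).1 h1
  obtain ⟨c, hc0, rfl⟩ := hr
  have h1 : ‖a - b‖ < s := hsub a (by simp)
  have h2 : ‖a + c - b‖ < s := hsub (a + c) (by simp)
  have h3 : ‖c‖ < s := by
    have := norm_sub_le_max' (a + c) b a
    rw [add_sub_cancel_left, norm_sub_rev b a] at this
    exact this.trans_lt (max_lt h2 h1)
  obtain ⟨(d : K), hd1, hd2⟩ := DenselyNormedField.lt_norm_lt (α := K) (max ‖c‖ ‖a - b‖) s
    ((norm_nonneg c).trans (le_max_left _ _)) (max_lt h3 h1)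
  have hd0 : d ≠ 0 := by
    rintro rfl
    rw [norm_zero] at hd1
    exact absurd hd1 (not_lt.2 ((norm_nonneg c).trans (le_max_left _ _)))
  refine ⟨P1.of '' {z : K | ‖z - b‖ < ‖d‖}, (P1.of '' {z : K | ‖z - b‖ ≤ ‖d‖})ᶜ,
    Or.inl ⟨_, ⟨b, ‖d‖, ⟨d, hd0, rfl⟩, rfl⟩, rfl⟩,
    Or.inr ⟨_, ⟨b, ‖d‖, ⟨d, hd0, rfl⟩, rfl⟩, rfl⟩, ?_, ?_, ?_⟩
  · rw [compl_compl]
    refine image_mono fun z (hz : ‖z - a‖ ≤ ‖c‖) => ?_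
    exact (norm_sub_le_max' z a b).trans_lt ((max_le_max_right _ hz).trans_lt hd1)
  · exact compl_subset_compl.2 (image_mono fun z (hz : ‖z - b‖ ≤ ‖d‖) => hz.trans_lt hd2)
  · exact disjoint_compl_right_iff_subset.2
      (image_mono fun z (hz : ‖z - b‖ < ‖d‖) => hz.le)

/-- Two open balls that cover the projective line have complements with disjoint
neighbourhoods that are open balls. -/
theorem exists_separate {D D' : Set (P1 K)} (hD : IsOpenBall D) (hD' : IsOpenBall D')
    (h : D ∪ D' = univ) : ∃ E E' : Set (P1 K), IsOpenBall E ∧ IsOpenBall E' ∧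
      Dᶜ ⊆ E ∧ D'ᶜ ⊆ E' ∧ Disjoint E E' := by
  rcases hD with ⟨B, ⟨a, r, hr, rfl⟩, rfl⟩ | ⟨B, ⟨a, r, hr, rfl⟩, rfl⟩ <;>
    rcases hD' with ⟨B', ⟨b, s, hs, rfl⟩, rfl⟩ | ⟨B', ⟨b, s, hs, rfl⟩, rfl⟩
  · exfalso
    have : P1.infty K ∈ P1.of '' {z : K | ‖z - a‖ < r} ∪ P1.of '' {z : K | ‖z - b‖ < s} :=
      h ▸ mem_univ _
    rcases this with h1 | h1 <;> exact infty_notMem_image h1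
  · rw [union_comm] at h
    obtain ⟨E, E', h1, h2, h3, h4, h5⟩ := separate_aux hs h
    exact ⟨E', E, h2, h1, h4, h3, h5.symm⟩
  · exact separate_aux hr h
  · have hdis : ∀ z : K, ‖z - a‖ ≤ r → ¬ ‖z - b‖ ≤ s := by
      intro z hz hz'
      have : P1.of z ∈ (P1.of '' {z : K | ‖z - a‖ ≤ r})ᶜ ∪ (P1.of '' {z : K | ‖z - b‖ ≤ s})ᶜ :=
        h ▸ mem_univ _
      rcases this with h1 | h1
      · exact h1 ((of_mem_image (B := {z : K | ‖z - a‖ ≤ r})).2 hz)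
      · exact h1 ((of_mem_image (B := {z : K | ‖z - b‖ ≤ s})).2 hz')
    have hr0 : 0 ≤ r := by obtain ⟨c, -, rfl⟩ := hr; exact norm_nonneg c
    have hs0 : 0 ≤ s := by obtain ⟨c, -, rfl⟩ := hs; exact norm_nonneg c
    have h1 : s < ‖a - b‖ := not_le.1 (hdis a (by simpa using hr0))
    have h2 : r < ‖a - b‖ := by
      by_contra hle
      push Not at hle
      rw [norm_sub_rev] at hle
      exact hdis b hle (by simpa using hs0)
    have hv : ‖a - b‖ ∈ valueGroup K :=
      ⟨a - b, norm_pos_iff.1 (hr0.trans_lt h2), rfl⟩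
    refine ⟨P1.of '' {z : K | ‖z - a‖ < ‖a - b‖}, P1.of '' {z : K | ‖z - b‖ < ‖a - b‖},
      Or.inl ⟨_, ⟨a, _, hv, rfl⟩, rfl⟩, Or.inl ⟨_, ⟨b, _, hv, rfl⟩, rfl⟩, ?_, ?_, ?_⟩
    · rw [compl_compl]
      exact image_mono fun z (hz : ‖z - a‖ ≤ r) => hz.trans_lt h2
    · rw [compl_compl]
      exact image_mono fun z (hz : ‖z - b‖ ≤ s) => hz.trans_lt h1
    · rw [disjoint_image_iff P1.of_injective, Set.disjoint_left]
      intro z (hz : ‖z - a‖ < ‖a - b‖) (hz' : ‖z - b‖ < ‖a - b‖)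
      have := norm_sub_le_max' a z b
      rw [norm_sub_rev a z] at this
      exact absurd this (not_le.2 (max_lt hz hz'))

/-- Every finite covering by open affinoids has a finite point-star refinement by open
affinoids. -/
theorem exists_star_refinement [Infinite (ResField K)] {C : Set (Set (P1 K))}
    (hC : IsAffinoidCover C) : ∃ C' : Set (Set (P1 K)), IsAffinoidCover C' ∧
      ∀ x : P1 K, ∃ Y ∈ C, ∀ Y' ∈ C', x ∈ Y' → Y' ⊆ Y := by
  classical
  obtain ⟨hfin, haff, hcov⟩ := hC
  choose! s hs hb he using haff
  let S : Set (Set (P1 K)) := ⋃ Y ∈ C, s Y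
  have hS : S.Finite := hfin.biUnion hs
  have hSb : ∀ D ∈ S, IsOpenBall D := by
    intro D hD
    obtain ⟨Y, hY, hD⟩ := mem_iUnion₂.1 hD
    exact hb Y hY D hD
  have hsep : ∀ D D' : Set (P1 K), (D ∈ S ∧ D' ∈ S ∧ D ∪ D' = univ) →
      ∃ E E' : Set (P1 K), IsOpenBall E ∧ IsOpenBall E' ∧
        Dᶜ ⊆ E ∧ D'ᶜ ⊆ E' ∧ Disjoint E E' :=
    fun D D' h => exists_separate (hSb D h.1) (hSb D' h.2.1) h.2.2
  choose! u v hu hv hDu hDv huv using hsep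
  -- an open affinoid neighbourhood of the complement of `D`
  let e : Set (P1 K) → Set (P1 K) := fun D =>
    ⋂₀ ((u D '' {D' | D' ∈ S ∧ D ∪ D' = univ}) ∪
      ((fun D' => v D' D) '' {D' | D' ∈ S ∧ D' ∪ D = univ}))
  have hefin : ∀ D, ((u D '' {D' | D' ∈ S ∧ D ∪ D' = univ}) ∪
      ((fun D' => v D' D) '' {D' | D' ∈ S ∧ D' ∪ D = univ})).Finite := fun D =>
    ((hS.subset fun _ h => h.1).image _).union ((hS.subset fun _ h => h.1).image _)
  have heaff : ∀ D ∈ S, IsOpenAffinoid (e D) := by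
    intro D hD
    refine isOpenAffinoid_sInter (hefin D) ?_
    rintro _ (⟨D', h, rfl⟩ | ⟨D', h, rfl⟩)
    · exact (hu D D' ⟨hD, h⟩).isOpenAffinoid
    · exact (hv D' D ⟨h.1, hD, h.2⟩).isOpenAffinoid
  have heD : ∀ D ∈ S, Dᶜ ⊆ e D := by
    intro D hD
    refine subset_sInter ?_
    rintro _ (⟨D', h, rfl⟩ | ⟨D', h, rfl⟩)
    · exact hDu D D' ⟨hD, h⟩
    · exact hDv D' D ⟨h.1, hD, h.2⟩
  have hdisj : ∀ D ∈ S, ∀ D' ∈ S, D ∪ D' = univ → Disjoint (e D) (e D') := by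
    intro D hD D' hD' h
    refine (huv D D' ⟨hD, hD', h⟩).mono ?_ ?_
    · exact sInter_subset_of_mem (Or.inl ⟨D', ⟨hD', h⟩, rfl⟩)
    · exact sInter_subset_of_mem (Or.inr ⟨D, ⟨hD, h⟩, rfl⟩)
  -- the refinement: intersections over `S` of a choice between `D` and `e D`
  let g : Set (Set (P1 K)) → Set (P1 K) := fun T => ⋂₀ (T ∪ e '' (S \ T))
  refine ⟨g '' {T | T ⊆ S}, ⟨hS.finite_subsets.image g, ?_, ?_⟩, ?_⟩
  · rintro _ ⟨T, hT, rfl⟩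
    refine isOpenAffinoid_sInter ((hS.subset hT).union ((hS.subset sdiff_subset).image e)) ?_
    rintro _ (hD | ⟨D, hD, rfl⟩)
    · exact (hSb _ (hT hD)).isOpenAffinoid
    · exact heaff D hD.1
  · refine eq_univ_of_forall fun x => ?_
    refine ⟨_, ⟨{D | D ∈ S ∧ x ∈ D}, fun D hD => hD.1, rfl⟩, ?_⟩
    rintro _ (hD | ⟨D, hD, rfl⟩)
    · exact hD.2
    · exact heD D hD.1 fun hx => hD.2 ⟨hD.1, hx⟩
  · intro x
    have hx : ∃ Y ∈ C, ∀ D ∈ s Y, x ∉ e D := by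
      by_contra hno
      push Not at hno
      choose! d hd hxd using hno
      have hdS : ∀ Y ∈ C, d Y ∈ S := fun Y hY => mem_iUnion₂.2 ⟨Y, hY, hd Y hY⟩
      obtain ⟨_, ⟨Y, hY, rfl⟩, _, ⟨Y', hY', rfl⟩, h⟩ :=
        exists_pair_cover (S := d '' C) (hfin.image d)
          (by rintro _ ⟨Y, hY, rfl⟩; exact hSb _ (hdS Y hY))
          (by
            refine eq_univ_of_forall fun y => ?_
            have : y ∈ ⋃₀ C := hcov ▸ mem_univ y
            obtain ⟨Y, hY, hy⟩ := this
            rw [he Y hY] at hy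
            exact ⟨d Y, ⟨Y, hY, rfl⟩, hy _ (hd Y hY)⟩)
      exact Set.disjoint_left.1 (hdisj _ (hdS Y hY) _ (hdS Y' hY') h) (hxd Y hY) (hxd Y' hY')
    obtain ⟨Y, hY, hxY⟩ := hx
    refine ⟨Y, hY, ?_⟩
    rintro _ ⟨T, hT, rfl⟩ hxT
    rw [he Y hY]
    refine subset_sInter fun D hD => sInter_subset_of_mem (Or.inl ?_)
    by_contra hDT
    exact hxY D hD (hxT _ (Or.inr ⟨D, ⟨mem_iUnion₂.2 ⟨Y, hY, hD⟩, hDT⟩, rfl⟩))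

/-- The filter on `ℙ¹ × ℙ¹` of all sets that contain some `V(C)`, for `C` a finite covering
by open affinoids. -/
def affinoidUniformity (K : Type*) [NormedField K] : Filter (P1 K × P1 K) where
  sets := {V | ∃ C, IsAffinoidCover C ∧ coverRel C ⊆ V}
  univ_sets := ⟨{univ}, ⟨finite_singleton _, by
    rintro _ rfl
    exact ⟨∅, finite_empty, by simp, by simp⟩, by simp⟩, subset_univ _⟩
  sets_of_superset := by
    rintro V W ⟨C, hC, h⟩ hVW
    exact ⟨C, hC, h.trans hVW⟩
  inter_sets := by
    rintro V W ⟨C, ⟨hC1, hC2, hC3⟩, hV⟩ ⟨C', ⟨hC1', hC2', hC3'⟩, hW⟩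
    refine ⟨image2 (· ∩ ·) C C', ⟨hC1.image2 _ hC1', ?_, ?_⟩, ?_⟩
    · rintro _ ⟨Y, hY, Y', hY', rfl⟩
      have := isOpenAffinoid_sInter (s := {Y, Y'}) (by simp)
        (by rintro _ (rfl | rfl); exacts [hC2 _ hY, hC2' _ hY'])
      simpa using this
    · refine eq_univ_of_forall fun x => ?_
      obtain ⟨Y, hY, hx⟩ : x ∈ ⋃₀ C := hC3 ▸ mem_univ x
      obtain ⟨Y', hY', hx'⟩ : x ∈ ⋃₀ C' := hC3' ▸ mem_univ x
      exact ⟨Y ∩ Y', ⟨Y, hY, Y', hY', rfl⟩, hx, hx'⟩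
    · intro p hp
      obtain ⟨_, ⟨Y, hY, Y', hY', rfl⟩, h1, h2⟩ := mem_iUnion₂.1 hp
      exact ⟨hV (mem_iUnion₂.2 ⟨Y, hY, h1.1, h2.1⟩), hW (mem_iUnion₂.2 ⟨Y', hY', h1.2, h2.2⟩)⟩

/-- The projective line with the uniform structure of finite coverings by open affinoids. -/
instance [Infinite (ResField K)] : UniformSpace (P1 K) :=
  UniformSpace.ofCore <| UniformSpace.Core.mk' (affinoidUniformity K)
    (by
      rintro V ⟨C, hC, hV⟩ x
      obtain ⟨Y, hY, hx⟩ : x ∈ ⋃₀ C := hC.2.2 ▸ mem_univ x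
      exact hV (mem_iUnion₂.2 ⟨Y, hY, hx, hx⟩))
    (by
      rintro V ⟨C, hC, hV⟩
      refine ⟨C, hC, fun p hp => hV ?_⟩
      obtain ⟨Y, hY, h1, h2⟩ := mem_iUnion₂.1 hp
      exact mem_iUnion₂.2 ⟨Y, hY, h2, h1⟩)
    (by
      rintro V ⟨C, hC, hV⟩
      obtain ⟨C', hC', hstar⟩ := exists_star_refinement hC
      refine ⟨coverRel C', ⟨C', hC', Subset.rfl⟩, ?_⟩
      rintro ⟨x, z⟩ ⟨y, hxy, hyz⟩
      obtain ⟨Y, hY, h1, h2⟩ := mem_iUnion₂.1 hxy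
      obtain ⟨Y', hY', h3, h4⟩ := mem_iUnion₂.1 hyz
      obtain ⟨W, hW, hsub⟩ := hstar y
      exact hV (mem_iUnion₂.2 ⟨W, hW, hsub Y hY h2 h1, hsub Y' hY' h3 h4⟩))

theorem mem_uniformity_P1 [Infinite (ResField K)] {V : Set (P1 K × P1 K)} :
    V ∈ 𝓤 (P1 K) ↔ ∃ C, IsAffinoidCover C ∧ coverRel C ⊆ V := Iff.rfl

end Uniform2

/-! ### The compactification: minimal Cauchy filters -/

section Ber

variable (K : Type*) [DenselyNormedField K] [IsUltrametricDist K] [Infinite (ResField K)]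

/-- The compactification: the set of minimal Cauchy filters on the projective line, that is,
the Cauchy filters `F` such that no Cauchy filter is strictly coarser than `F`. It is the
Hausdorff completion of the projective line. -/
def Ber : Type _ :=
  {F : CauchyFilter (P1 K) // ∀ G : Filter (P1 K), Cauchy G → F.1 ≤ G → G = F.1}

/-- The uniform structure on minimal Cauchy filters; an entourage contains, for some entourage
`V` of the projective line, all the pairs `(F, G)` with `V ∈ F ×ˢ G`. -/
instance : UniformSpace (Ber K) := inferInstanceAs (UniformSpace {F : CauchyFilter (P1 K) //
  ∀ G : Filter (P1 K), Cauchy G → F.1 ≤ G → G = F.1})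

variable {K}

/-- The underlying filter of a point. -/
def Ber.filter (F : Ber K) : Filter (P1 K) := F.1.1

/-- A point of the projective line, as the minimal Cauchy filter of its neighbourhoods. -/
def P1.toBer (x : P1 K) : Ber K :=
  ⟨⟨𝓝 x, cauchy_nhds⟩, by
    intro G hG (hle : 𝓝 x ≤ G)
    refine le_antisymm ?_ hle
    intro U hU
    obtain ⟨V, hV, hVU⟩ := UniformSpace.mem_nhds_iff.1 hU
    obtain ⟨A, hA, hAV⟩ := cauchy_iff.1 hG |>.2 V hV
    have hx : x ∈ A := mem_of_mem_nhds (hle hA)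
    exact mem_of_superset hA fun y hy => hVU (hAV (mk_mem_prod hx hy))⟩

/-- For a set `Y` of points of the projective line, the set of the points of the
compactification that contain `Y`. The open balls of the compactification are the sets
`Ber.hat B`, for `B` an open or irrational ball. -/
def Ber.hat (Y : Set (P1 K)) : Set (Ber K) := {F | Y ∈ F.filter}

/-- For a set `Y` of points of the projective line, the topological closure of `Y` in the
compactification. The closed balls of the compactification are the sets `Ber.cl B`, for `B` a
closed or irrational ball. -/
def Ber.cl (Y : Set (P1 K)) : Set (Ber K) := closure (P1.toBer '' Y)

/-- The intersection `B_F` of all the balls of `K` that belong to the filter `F`. -/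
def Ber.ball (F : Ber K) : Set K := ⋂₀ {B : Set K | IsBallK B ∧ P1.of '' B ∈ F.filter}

end Ber

/-! ### The tree of balls of `K` -/

section KTree

variable (K : Type*) [NormedField K] [IsUltrametricDist K]

/-- The equivalence relation on `K × [0, ∞)`: `(x, r) ∼ (x', r')` if and only if `r = r'` and
`|x - x'| ≤ r`. -/
def ballSetoid : Setoid (K × ℝ≥0) where
  r p q := p.2 = q.2 ∧ dist p.1 q.1 ≤ p.2
  iseqv :=
    { refl := fun p => ⟨rfl, by simp⟩
      symm := fun {p q} h => ⟨h.1.symm, by rw [dist_comm, ← h.1]; exact h.2⟩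
      trans := fun {p q s} h h' => ⟨h.1.trans h'.1,
        (dist_triangle_max p.1 q.1 s.1).trans (max_le h.2 (by rw [h.1]; exact h'.2))⟩ }

/-- The space of balls, the quotient of `K × [0, ∞)`. -/
def BallTree : Type _ := Quotient (ballSetoid K)

variable {K}

namespace BallTree

/-- The point `[x, r]`. -/
def mk (x : K) (r : ℝ≥0) : BallTree K := Quotient.mk (ballSetoid K) (x, r)

/-- The points of `K`, as `[x, 0]`. -/
def ofPoint (x : K) : BallTree K := mk x 0

/-- The set `B_S`; for `S = [x, r]` it is the set of all `w` with `|w - x| ≤ r`. -/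
def ball : BallTree K → Set K :=
  Quotient.lift (fun p : K × ℝ≥0 => {w : K | dist w p.1 ≤ p.2}) (by
    rintro ⟨x, r⟩ ⟨y, s⟩ ⟨h1, h2⟩
    obtain rfl : r = s := h1
    have h2 : dist x y ≤ r := h2
    ext w
    simp only [mem_ofPred_eq]
    constructor
    · exact fun h => (dist_triangle_max w x y).trans (max_le h h2)
    · exact fun h => (dist_triangle_max w y x).trans (max_le h (by rwa [dist_comm])))

/-- `diam [x, r] = r`. -/
def diam : BallTree K → ℝ :=
  Quotient.lift (fun p : K × ℝ≥0 => (p.2 : ℝ)) (by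
    rintro ⟨x, r⟩ ⟨y, s⟩ ⟨h1, -⟩
    exact congrArg _ h1)

theorem sup_aux {x x' y y' : K} {r s : ℝ≥0} (h : dist x x' ≤ r) (h' : dist y y' ≤ s) :
    max (max (r : ℝ) s) (dist x y) ≤ max (max (r : ℝ) s) (dist x' y') := by
  refine max_le (le_max_left _ _) ?_
  refine (dist_triangle_max x x' y).trans (max_le ?_ ((dist_triangle_max x' y' y).trans
    (max_le (le_max_right _ _) ?_)))
  · exact h.trans ((le_max_left _ _).trans (le_max_left _ _))
  · rw [dist_comm]
    exact h'.trans ((le_max_right _ _).trans (le_max_left _ _))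

/-- `sup {[x, r], [x', r']} = max {r, r', |x - x'|}`. -/
def sup : BallTree K → BallTree K → ℝ :=
  Quotient.lift₂ (fun p q : K × ℝ≥0 => max (max (p.2 : ℝ) q.2) (dist p.1 q.1)) (by
    rintro ⟨x, r⟩ ⟨y, s⟩ ⟨x', r'⟩ ⟨y', s'⟩ ⟨h1, h2⟩ ⟨h3, h4⟩
    obtain rfl : r = r' := h1
    obtain rfl : s = s' := h3
    refine le_antisymm (sup_aux h2 h4) (sup_aux ?_ ?_)
    · rw [dist_comm]; exact h2
    · rw [dist_comm]; exact h4)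

/-- `|[x, r]| = max {|x|, r}`. -/
def abs : BallTree K → ℝ :=
  Quotient.lift (fun p : K × ℝ≥0 => max ‖p.1‖ (p.2 : ℝ)) (by
    rintro ⟨x, r⟩ ⟨y, s⟩ ⟨h1, h2⟩
    obtain rfl : r = s := h1
    have h2 : dist x y ≤ r := h2
    have hxy := dist_triangle_max x y 0
    have hyx := dist_triangle_max y x 0
    rw [dist_zero_right, dist_zero_right] at hxy hyx
    rw [dist_comm y x] at hyx
    refine le_antisymm (max_le ?_ (le_max_right _ _)) (max_le ?_ (le_max_right _ _))
    · exact hxy.trans (max_le (h2.trans (le_max_right _ _)) (le_max_left _ _))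
    · exact hyx.trans (max_le (h2.trans (le_max_right _ _)) (le_max_left _ _)))

theorem sup_self (S : BallTree K) : sup S S = diam S := by
  induction S using Quotient.ind with
  | _ p => simp [sup, diam]

theorem sup_comm (S T : BallTree K) : sup S T = sup T S := by
  induction S using Quotient.ind with
  | _ p =>
    induction T using Quotient.ind with
    | _ q => simp only [sup, Quotient.lift_mk]; rw [max_comm (p.2 : ℝ), dist_comm]

theorem sup_ultra (S T U : BallTree K) : sup S U ≤ max (sup S T) (sup T U) := by
  induction S using Quotient.ind with
  | _ p =>
    induction T using Quotient.ind with
    | _ q =>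
      induction U using Quotient.ind with
      | _ s =>
        simp only [sup, Quotient.lift_mk]
        refine max_le (max_le ?_ ?_) ((dist_triangle_max _ q.1 _).trans ?_)
        · exact le_max_of_le_left (le_max_of_le_left (le_max_left _ _))
        · exact le_max_of_le_right (le_max_of_le_left (le_max_right _ _))
        · exact max_le_max (le_max_right _ _) (le_max_right _ _)

theorem diam_nonneg (S : BallTree K) : 0 ≤ diam S := by
  induction S using Quotient.ind with
  | _ p => exact p.2.2

theorem abs_eq_sup (S : BallTree K) : abs S = sup S (ofPoint 0) := by
  induction S using Quotient.ind with
  | _ p => simp [abs, sup, ofPoint, mk, max_comm]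

theorem eq_of_sup_eq {S T : BallTree K} (h : sup S T = diam S) (h' : sup S T = diam T) :
    S = T := by
  induction S using Quotient.ind with
  | _ p =>
    induction T using Quotient.ind with
    | _ q =>
      simp only [sup, diam, Quotient.lift_mk] at h h'
      exact Quotient.sound ⟨NNReal.coe_injective (h.symm.trans h'), h ▸ le_max_right _ _⟩

theorem diam_le_sup (S T : BallTree K) : diam S ≤ sup S T := by
  have := sup_ultra S T S
  rwa [sup_comm T S, max_self, sup_self] at this

/-- The distance `δ(S, S') = sup {S, S'} - (diam S + diam S') / 2`. -/
instance : MetricSpace (BallTree K) where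
  dist S T := sup S T - (diam S + diam T) / 2
  dist_self S := by
    show sup S S - (diam S + diam S) / 2 = 0
    rw [sup_self]; ring
  dist_comm S T := by
    show sup S T - (diam S + diam T) / 2 = sup T S - (diam T + diam S) / 2
    rw [sup_comm]; ring
  dist_triangle S T U := by
    show sup S U - (diam S + diam U) / 2 ≤
      (sup S T - (diam S + diam T) / 2) + (sup T U - (diam T + diam U) / 2)
    have h1 := diam_le_sup T U
    have h2 := diam_le_sup T S
    rw [sup_comm] at h2
    rcases le_max_iff.1 (sup_ultra S T U) with h | h <;> linarith
  eq_of_dist_eq_zero {S T} h := by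
    have h : sup S T - (diam S + diam T) / 2 = 0 := h
    have h1 := diam_le_sup S T
    have h2 := diam_le_sup T S
    rw [sup_comm] at h2
    exact eq_of_sup_eq (by linarith) (by linarith)

theorem dist_def (S T : BallTree K) : dist S T = sup S T - (diam S + diam T) / 2 := rfl

theorem abs_diam_sub_le (S T : BallTree K) : |diam S - diam T| ≤ 2 * dist S T := by
  have h1 := diam_le_sup S T
  have h2 := diam_le_sup T S
  rw [sup_comm] at h2
  rw [dist_def, abs_le]
  constructor <;> linarith

theorem uniformContinuous_diam : UniformContinuous (diam : BallTree K → ℝ) :=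
  (LipschitzWith.of_dist_le_mul (K := 2) fun S T => by
    rw [Real.dist_eq]; exact abs_diam_sub_le S T).uniformContinuous

theorem uniformContinuous_sup : UniformContinuous₂ (sup : BallTree K → BallTree K → ℝ) := by
  have h : (fun p : BallTree K × BallTree K => sup p.1 p.2) =
      fun p => dist p.1 p.2 + (diam p.1 + diam p.2) * (1 / 2) := by
    funext p; rw [dist_def]; ring
  show UniformContinuous (fun p : BallTree K × BallTree K => sup p.1 p.2)
  rw [h]
  have h1 := uniformContinuous_diam.comp (uniformContinuous_fst (α := BallTree K) (β := BallTree K))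
  have h2 := uniformContinuous_diam.comp (uniformContinuous_snd (α := BallTree K) (β := BallTree K))
  exact (uniformContinuous_fst.dist uniformContinuous_snd).add
    ((h1.add h2).mul_const' (1 / 2))

theorem uniformContinuous_abs : UniformContinuous (abs : BallTree K → ℝ) := by
  have : (abs : BallTree K → ℝ) = fun S => sup S (ofPoint 0) := funext abs_eq_sup
  rw [this]
  have h : UniformContinuous fun p : BallTree K × BallTree K => sup p.1 p.2 :=
    uniformContinuous_sup
  exact h.comp (uniformContinuous_id.prodMk uniformContinuous_const)

end BallTree

variable (K) in
/-- The tree of `K`: the completion of the space of balls for the distance `δ`. -/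
abbrev KTree : Type _ := UniformSpace.Completion (BallTree K)

namespace KTree

/-- The points of `K` in the tree. -/
def ofPoint (x : K) : KTree K := ((BallTree.ofPoint x : BallTree K) : KTree K)

/-- The continuous extension of `diam`. -/
def diam : KTree K → ℝ := UniformSpace.Completion.extension BallTree.diam

/-- The continuous extension of `|·|`. -/
def abs : KTree K → ℝ := UniformSpace.Completion.extension BallTree.abs

/-- The continuous extension of `sup {·, ·}`. -/
def sup : KTree K → KTree K → ℝ := UniformSpace.Completion.extension₂ BallTree.sup

theorem diam_coe (S : BallTree K) : diam (S : KTree K) = S.diam :=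
  UniformSpace.Completion.extension_coe BallTree.uniformContinuous_diam S

theorem abs_coe (S : BallTree K) : abs (S : KTree K) = S.abs :=
  UniformSpace.Completion.extension_coe BallTree.uniformContinuous_abs S

theorem sup_coe (S T : BallTree K) : sup (S : KTree K) (T : KTree K) = S.sup T :=
  UniformSpace.Completion.extension₂_coe_coe BallTree.uniformContinuous_sup S T

theorem continuous_diam : Continuous (diam : KTree K → ℝ) :=
  UniformSpace.Completion.continuous_extension

theorem continuous_abs : Continuous (abs : KTree K → ℝ) :=
  UniformSpace.Completion.continuous_extension

theorem continuous_sup : Continuous fun p : KTree K × KTree K => sup p.1 p.2 :=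
  (UniformSpace.Completion.uniformContinuous_extension₂ (BallTree.sup (K := K))).continuous

theorem sup_self (S : KTree K) : sup S S = diam S := by
  induction S using UniformSpace.Completion.induction_on with
  | hp =>
    exact isClosed_eq (continuous_sup.comp (continuous_id.prodMk continuous_id)) continuous_diam
  | ih S => rw [sup_coe, diam_coe, BallTree.sup_self]

theorem sup_comm (S T : KTree K) : sup S T = sup T S := by
  induction S, T using UniformSpace.Completion.induction_on₂ with
  | hp => exact isClosed_eq continuous_sup (continuous_sup.comp continuous_swap)
  | ih S T => rw [sup_coe, sup_coe, BallTree.sup_comm]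

theorem sup_ultra (S T U : KTree K) : sup S U ≤ max (sup S T) (sup T U) := by
  induction S, T, U using UniformSpace.Completion.induction_on₃ with
  | hp =>
    have h1 : Continuous fun p : KTree K × KTree K × KTree K => sup p.1 p.2.2 :=
      continuous_sup.comp (continuous_fst.prodMk (continuous_snd.comp continuous_snd))
    have h2 : Continuous fun p : KTree K × KTree K × KTree K => sup p.1 p.2.1 :=
      continuous_sup.comp (continuous_fst.prodMk (continuous_fst.comp continuous_snd))
    have h3 : Continuous fun p : KTree K × KTree K × KTree K => sup p.2.1 p.2.2 :=
      continuous_sup.comp continuous_snd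
    exact isClosed_le h1 (h2.max h3)
  | ih S T U => simpa only [sup_coe] using BallTree.sup_ultra S T U

theorem diam_nonneg (S : KTree K) : 0 ≤ diam S := by
  induction S using UniformSpace.Completion.induction_on with
  | hp => exact isClosed_le continuous_const continuous_diam
  | ih S => rw [diam_coe]; exact S.diam_nonneg

theorem abs_eq_sup (S : KTree K) : abs S = sup S (ofPoint 0) := by
  induction S using UniformSpace.Completion.induction_on with
  | hp =>
    exact isClosed_eq continuous_abs
      (continuous_sup.comp (continuous_id.prodMk continuous_const))
  | ih S => rw [abs_coe, ofPoint, sup_coe, BallTree.abs_eq_sup]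

theorem dist_eq (S T : KTree K) : dist S T = sup S T - (diam S + diam T) / 2 := by
  induction S, T using UniformSpace.Completion.induction_on₂ with
  | hp =>
    exact isClosed_eq continuous_dist (continuous_sup.sub
      (((continuous_diam.comp continuous_fst).add
        (continuous_diam.comp continuous_snd)).div_const 2))
  | ih S T => rw [UniformSpace.Completion.dist_eq, sup_coe, diam_coe, diam_coe]; rfl

theorem diam_le_sup (S T : KTree K) : diam S ≤ sup S T := by
  have := sup_ultra S T S
  rwa [sup_comm T S, max_self, sup_self] at this

theorem diam_le_abs (S : KTree K) : diam S ≤ abs S := by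
  rw [abs_eq_sup]; exact diam_le_sup _ _

/-- Open balls of the tree. -/
def IsOpenBall (D : Set (KTree K)) : Prop :=
  ∃ x : K, ∃ r : ℝ, 0 < r ∧ D = {S | sup (ofPoint x) S < r}

/-- Closed balls of the tree. -/
def IsClosedBall (D : Set (KTree K)) : Prop :=
  ∃ x : K, ∃ r : ℝ, 0 < r ∧ D = {S | sup (ofPoint x) S ≤ r}

end KTree

variable (K) in
/-- The projective tree: the tree of `K` together with a point at infinity. -/
inductive ProjTree : Type _
  | of (S : KTree K) : ProjTree
  | infty : ProjTree

namespace ProjTree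

/-- `h(S) = max {1, |S|}`. -/
def height (S : KTree K) : ℝ := max 1 (KTree.abs S)

/-- The chordal distance `Δ`. On the tree of `K` it is
`sup {S, T} / (h(S) h(T)) - diam S / (2 h(S)²) - diam T / (2 h(T)²)`, with `h = max {1, |·|}`;
the value `Δ(S, ∞)` is the limit of `Δ(S, T)` as `|T|` tends to infinity. -/
def chordal : ProjTree K → ProjTree K → ℝ
  | of S, of T => KTree.sup S T / (height S * height T)
      - KTree.diam S / (2 * height S ^ 2) - KTree.diam T / (2 * height T ^ 2)
  | of S, infty => 1 / height S - KTree.diam S / (2 * height S ^ 2)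
  | infty, of T => 1 / height T - KTree.diam T / (2 * height T ^ 2)
  | infty, infty => 0

/-- An auxiliary ultrametric function. -/
def csup : ProjTree K → ProjTree K → ℝ
  | of S, of T => KTree.sup S T / (height S * height T)
  | of S, infty => 1 / height S
  | infty, of T => 1 / height T
  | infty, infty => 0

theorem one_le_height (S : KTree K) : 1 ≤ height S := le_max_left _ _

theorem height_pos (S : KTree K) : 0 < height S := one_pos.trans_le (one_le_height S)

theorem chordal_eq (P Q : ProjTree K) :
    chordal P Q = csup P Q - (csup P P + csup Q Q) / 2 := by
  have h : ∀ S : KTree K, height S ≠ 0 := fun S => (height_pos S).ne'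
  rcases P with S | _ <;> rcases Q with T | _ <;> simp only [chordal, csup, KTree.sup_self]
  · have hS := h S
    have hT := h T
    field_simp
    ring
  · have hS := h S
    field_simp
    ring
  · have hT := h T
    field_simp
    ring
  · ring

theorem csup_comm (P Q : ProjTree K) : csup P Q = csup Q P := by
  cases P <;> cases Q <;> simp only [csup]
  rw [KTree.sup_comm, mul_comm]

theorem height_le (S T : KTree K) : height S ≤ max (KTree.sup S T) (height T) := by
  refine max_le (le_max_of_le_right (one_le_height T)) ?_
  rw [KTree.abs_eq_sup]
  refine (KTree.sup_ultra S T _).trans (max_le_max_left _ ?_)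
  rw [← KTree.abs_eq_sup]
  exact le_max_right _ _

theorem sup_le_height (S T : KTree K) : KTree.sup S T ≤ max (height S) (height T) := by
  refine (KTree.sup_ultra S (KTree.ofPoint 0) T).trans ?_
  rw [KTree.sup_comm (KTree.ofPoint 0), ← KTree.abs_eq_sup, ← KTree.abs_eq_sup]
  exact max_le_max (le_max_right _ _) (le_max_right _ _)

theorem sup_nonneg (S T : KTree K) : 0 ≤ KTree.sup S T :=
  (KTree.diam_nonneg S).trans (KTree.diam_le_sup S T)

theorem ptolemy (S T U : KTree K) : height T * KTree.sup S U ≤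
    max (height U * KTree.sup S T) (height S * KTree.sup T U) := by
  wlog h : height S ≤ height U generalizing S U
  · have := this U S (le_of_not_ge h)
    rwa [KTree.sup_comm U S, KTree.sup_comm U T, KTree.sup_comm T S, max_comm] at this
  have hST := sup_nonneg S T
  have hTU := sup_nonneg T U
  have hSU := sup_nonneg S U
  have pS := height_pos S
  have pT := height_pos T
  have pU := height_pos U
  rcases le_or_gt (height T) (height S) with h1 | h1
  · rcases le_max_iff.1 (KTree.sup_ultra S T U) with h2 | h2
    · exact le_max_of_le_left (mul_le_mul (h1.trans h) h2 hSU pU.le)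
    · exact le_max_of_le_right (mul_le_mul h1 h2 hSU pS.le)
  · have h2 : height T ≤ KTree.sup S T := by
      have := height_le T S
      rw [KTree.sup_comm] at this
      exact (le_max_iff.1 this).resolve_right (not_le.2 h1)
    have h3 := sup_le_height S U
    rw [max_eq_right h] at h3
    refine le_max_of_le_left ?_
    rw [mul_comm (height U)]
    exact mul_le_mul h2 h3 hSU (pT.le.trans h2)

theorem csup_ultra (P Q R : ProjTree K) : csup P R ≤ max (csup P Q) (csup Q R) := by
  rcases P with S | _ <;> rcases Q with T | _ <;> rcases R with U | _ <;> simp only [csup]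
  · have pS := height_pos S
    have pT := height_pos T
    have pU := height_pos U
    rcases le_max_iff.1 (ptolemy S T U) with h | h
    · refine le_max_of_le_left ?_
      rw [div_le_div_iff₀ (by positivity) (by positivity)]
      nlinarith
    · refine le_max_of_le_right ?_
      rw [div_le_div_iff₀ (by positivity) (by positivity)]
      nlinarith
  · have pS := height_pos S
    have pT := height_pos T
    rcases le_max_iff.1 (height_le T S) with h | h
    · refine le_max_of_le_left ?_
      rw [KTree.sup_comm] at h
      rw [div_le_div_iff₀ (by positivity) (by positivity)]
      nlinarith
    · exact le_max_of_le_right (one_div_le_one_div_of_le pT h)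
  · have pS := height_pos S
    have pU := height_pos U
    rcases le_max_iff.1 (sup_le_height S U) with h | h
    · refine le_max_of_le_right ?_
      rw [div_le_div_iff₀ (by positivity) (by positivity)]
      nlinarith
    · refine le_max_of_le_left ?_
      rw [div_le_div_iff₀ (by positivity) (by positivity)]
      nlinarith
  · exact le_max_left _ _
  · have pT := height_pos T
    have pU := height_pos U
    rcases le_max_iff.1 (height_le T U) with h | h
    · refine le_max_of_le_right ?_
      rw [div_le_div_iff₀ (by positivity) (by positivity)]
      nlinarith
    · exact le_max_of_le_left (one_div_le_one_div_of_le pT h)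
  · have := height_pos T
    exact le_max_of_le_left (by positivity)
  · exact le_max_right _ _
  · exact le_max_left _ _

theorem csup_self_le (P Q : ProjTree K) : csup P P ≤ csup P Q := by
  have := csup_ultra P Q P
  rwa [csup_comm Q P, max_self] at this

theorem eq_of_csup_eq {P Q : ProjTree K} (h : csup P Q = csup P P) (h' : csup P Q = csup Q Q) :
    P = Q := by
  rcases P with S | _ <;> rcases Q with T | _ <;> simp only [csup] at h h'
  · have pS := height_pos S
    have pT := height_pos T
    have key : ∀ S T : KTree K, KTree.sup S T / (height S * height T) =
        KTree.sup T T / (height T * height T) → height T ≤ height S := by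
      intro S T h
      by_contra hlt
      push Not at hlt
      have pS := height_pos S
      have pT := height_pos T
      have h1 : height T ≤ KTree.sup S T := by
        have := height_le T S
        rw [KTree.sup_comm] at this
        exact (le_max_iff.1 this).resolve_right (not_le.2 hlt)
      have h2 : KTree.sup T T ≤ height T := by
        simpa using sup_le_height T T
      rw [div_eq_div_iff (by positivity) (by positivity)] at h
      have h3 : KTree.sup T T * (height S * height T) ≤ height T * (height S * height T) :=
        mul_le_mul_of_nonneg_right h2 (by positivity)
      have h4 : height T * (height T * height T) ≤ KTree.sup S T * (height T * height T) :=
        mul_le_mul_of_nonneg_right h1 (by positivity)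
      have h5 : height S * (height T * height T) < height T * (height T * height T) :=
        mul_lt_mul_of_pos_right hlt (by positivity)
      nlinarith
    have hT : height T ≤ height S := key S T h'
    have hS : height S ≤ height T := by
      apply key T S
      rw [KTree.sup_comm, mul_comm]
      exact h
    have he : height S = height T := le_antisymm hS hT
    rw [he] at h h'
    have h1 : KTree.sup S T = KTree.sup S S := by
      field_simp at h; exact h
    have h2 : KTree.sup S T = KTree.sup T T := by
      field_simp at h'; exact h'
    rw [KTree.sup_self] at h1 h2
    congr 1
    refine dist_eq_zero.1 ?_
    rw [KTree.dist_eq]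
    linarith
  · have := height_pos S
    have : 0 < 1 / height S := by positivity
    linarith
  · have := height_pos T
    have : 0 < 1 / height T := by positivity
    linarith
  · rfl

instance : MetricSpace (ProjTree K) where
  dist := chordal
  dist_self P := by
    show chordal P P = 0
    rw [chordal_eq]; ring
  dist_comm P Q := by
    show chordal P Q = chordal Q P
    rw [chordal_eq, chordal_eq, csup_comm]; ring
  dist_triangle P Q R := by
    show chordal P R ≤ chordal P Q + chordal Q R
    rw [chordal_eq, chordal_eq, chordal_eq]
    have h1 := csup_self_le Q R
    have h2 := csup_self_le Q P
    rw [csup_comm] at h2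
    rw [csup_comm Q P] at h2
    rcases le_max_iff.1 (csup_ultra P Q R) with h | h <;> linarith
  eq_of_dist_eq_zero {P Q} h := by
    have h : chordal P Q = 0 := h
    rw [chordal_eq] at h
    have h1 := csup_self_le P Q
    have h2 := csup_self_le Q P
    rw [csup_comm Q P] at h2
    exact eq_of_csup_eq (by linarith) (by linarith)

/-- The points of the space of balls, as points of the projective tree. -/
def ofBall (S : BallTree K) : ProjTree K := of (S : KTree K)

/-- The points of the projective line that belong to a set `D` of points of the projective
tree; the projective line is identified with `K` together with the point at infinity. -/
def trace (D : Set (ProjTree K)) : Set (P1 K) :=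
  {p | (∃ x : K, p = P1.of x ∧ of (KTree.ofPoint x) ∈ D) ∨ (p = P1.infty K ∧ infty ∈ D)}

/-- Open balls of the projective tree. -/
def IsOpenBall (D : Set (ProjTree K)) : Prop :=
  (∃ E : Set (KTree K), KTree.IsOpenBall E ∧ D = of '' E) ∨
    ∃ E : Set (KTree K), KTree.IsClosedBall E ∧ D = (of '' E)ᶜ

/-- Closed balls of the projective tree. -/
def IsClosedBall (D : Set (ProjTree K)) : Prop :=
  (∃ E : Set (KTree K), KTree.IsClosedBall E ∧ D = of '' E) ∨
    ∃ E : Set (KTree K), KTree.IsOpenBall E ∧ D = (of '' E)ᶜ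

end ProjTree

end KTree

end BerkLine

end

open BerkLine

/-!
A point `P` of the tree (or `∞`) is sent to the filter on `ℙ¹` generated by the traces of the open
balls containing `P`. Because the residue field is infinite, a finite covering of `ℙ¹` by open balls
already contains two balls that cover, so the uniform structure of `ℙ¹` is generated by the
coverings `{|z - x| < s}`, `{|z - x| > r}` with `0 < r < s`. Hence a filter is Cauchy exactly when
for all such `x`, `r`, `s` it contains one of these two sets. The discs in a Cauchy filter pairwise
meet, so they form a chain whose limit in the complete tree is a point `P`, or there are none and
`P = ∞`; either way the Cauchy filter refines the filter of `P`.

Conversely the ball `D` can be read off the filter of `P`: its trace is a member if and only if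
`P ∈ D`. For `P = [x, r]` this rests on the density of the value group, which provides points of `K`
on both sides of the sphere `|z - x| = r` and arbitrarily near to it. This gives injectivity and the
correspondence of balls. Uniform continuity holds because, in terms of `Δ`, the closed ball of
radius `r` around `x` has a uniform neighbourhood inside the open ball of radius `s > r`.
-/

noncomputable section

namespace BerkLine

section Radii

variable {K : Type*} [NormedField K]

theorem pos_of_mem_valueGroup {r : ℝ} (hr : r ∈ valueGroup K) : 0 < r := by
  obtain ⟨z, hz, rfl⟩ := hr
  exact norm_pos_iff.2 hz

theorem norm_ne_of_notMem_valueGroup {r : ℝ} (hr : 0 < r) (hv : r ∉ valueGroup K) (z : K) :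
    ‖z‖ ≠ r :=
  fun h => hv ⟨z, norm_pos_iff.1 (h ▸ hr), h⟩

theorem exists_norm_sub_eq_of_mem_valueGroup (a : K) {r : ℝ} (hr : r ∈ valueGroup K) :
    ∃ z : K, ‖z - a‖ = r := by
  obtain ⟨c, -, rfl⟩ := hr
  exact ⟨a + c, by rw [add_sub_cancel_left]⟩

end Radii

section DenseRadii

variable {K : Type*} [DenselyNormedField K]

theorem exists_mem_valueGroup_between {r s : ℝ} (hrs : r < s) (hs : 0 < s) :
    ∃ t ∈ valueGroup K, r < t ∧ t < s := by
  obtain ⟨z, hrz, hzs⟩ := NormedField.exists_lt_norm_lt K (le_max_right r 0) (max_lt hrs hs)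
  exact ⟨‖z‖, ⟨z, norm_pos_iff.1 ((le_max_right _ _).trans_lt hrz), rfl⟩,
    (le_max_left _ _).trans_lt hrz, hzs⟩

theorem frequently_mem_valueGroup_nhdsLT {r : ℝ} (hr : 0 < r) :
    ∃ᶠ t in 𝓝[<] r, t ∈ valueGroup K :=
  (nhdsLT_basis r).frequently_iff.2 fun {_} hq =>
    let ⟨t, ht, hqt, htr⟩ := exists_mem_valueGroup_between hq hr
    ⟨t, ⟨hqt, htr⟩, ht⟩

theorem frequently_mem_valueGroup_nhdsGT {r : ℝ} (hr : 0 ≤ r) :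
    ∃ᶠ t in 𝓝[>] r, t ∈ valueGroup K :=
  (nhdsGT_basis r).frequently_iff.2 fun {_} hq =>
    let ⟨t, ht, hrt, htq⟩ := exists_mem_valueGroup_between hq (hr.trans_lt hq)
    ⟨t, ⟨hrt, htq⟩, ht⟩

theorem le_of_closedBall_subset {a : K} {r s : ℝ} (hr : 0 < r)
    (h : {w | ‖w - a‖ ≤ r} ⊆ {w : K | ‖w - a‖ ≤ s}) : r ≤ s := by
  by_contra! hsr
  obtain ⟨t, ht, hst, htr⟩ := exists_mem_valueGroup_between (K := K) hsr hr
  obtain ⟨z, rfl⟩ := exists_norm_sub_eq_of_mem_valueGroup a ht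
  exact hst.not_ge (h htr.le)

end DenseRadii

namespace P1

section Balls

variable {K : Type*} [NormedField K]

/-- The set `{|z - x| < r}` in the projective line, for an arbitrary real `r`: an open or an
irrational ball when `r > 0`. -/
def openBall (x : K) (r : ℝ) : Set (P1 K) := P1.of '' {z | ‖z - x‖ < r}

/-- The set `{|z - x| ≤ r}` in the projective line, for an arbitrary real `r`: a closed or an
irrational ball when `r > 0`. -/
def closedBall (x : K) (r : ℝ) : Set (P1 K) := P1.of '' {z | ‖z - x‖ ≤ r}

variable {x y z : K} {r s : ℝ}

theorem of_mem_openBall : P1.of z ∈ openBall x r ↔ ‖z - x‖ < r := of_mem_image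

theorem of_mem_closedBall : P1.of z ∈ closedBall x r ↔ ‖z - x‖ ≤ r := of_mem_image

theorem infty_notMem_openBall : infty K ∉ openBall x r := infty_notMem_image

theorem infty_notMem_closedBall : infty K ∉ closedBall x r := infty_notMem_image

theorem openBall_subset_openBall (x : K) (h : r ≤ s) : openBall x r ⊆ openBall x s :=
  image_mono fun _ hz => lt_of_lt_of_le hz h

theorem closedBall_subset_closedBall (x : K) (h : r ≤ s) : closedBall x r ⊆ closedBall x s :=
  image_mono fun _ hz => le_trans hz h

theorem closedBall_subset_openBall (x : K) (h : r < s) : closedBall x r ⊆ openBall x s :=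
  image_mono fun _ hz => lt_of_le_of_lt hz h

theorem openBall_subset_closedBall (x : K) (r : ℝ) : openBall x r ⊆ closedBall x r :=
  image_mono fun _ => le_of_lt (α := ℝ)

theorem openBall_union_compl_closedBall (x : K) (h : r < s) :
    openBall x s ∪ (closedBall x r)ᶜ = univ :=
  eq_univ_of_forall fun _ => or_iff_not_imp_right.2 fun hp =>
    closedBall_subset_openBall x h (not_not.1 hp)

theorem openBall_eq_closedBall (x : K) (hr : 0 < r) (hv : r ∉ valueGroup K) :
    openBall x r = closedBall x r := by
  simp only [openBall, closedBall, (norm_ne_of_notMem_valueGroup hr hv _).le_iff_lt]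

theorem isOpenBall_openBall (x : K) (hr : r ∈ valueGroup K) : IsOpenBall (openBall x r) :=
  Or.inl ⟨_, ⟨x, r, hr, rfl⟩, rfl⟩

theorem isOpenBall_compl_closedBall (x : K) (hr : r ∈ valueGroup K) :
    IsOpenBall (closedBall x r)ᶜ :=
  Or.inr ⟨_, ⟨x, r, hr, rfl⟩, rfl⟩

variable [IsUltrametricDist K]

theorem openBall_subset_openBall_of_norm_sub_lt (h : ‖y - x‖ < s) :
    openBall y s ⊆ openBall x s :=
  image_mono fun z hz => (norm_sub_le_max' z y x).trans_lt (max_lt hz h)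

theorem openBall_norm_sub_subset_compl_closedBall (h : r < ‖x - y‖) :
    openBall x ‖x - y‖ ⊆ (closedBall y r)ᶜ := by
  rintro _ ⟨z, hz, rfl⟩
  rw [mem_compl_iff, of_mem_closedBall, not_le,
    IsUltrametricDist.norm_sub_eq_max_of_norm_sub_ne_norm_sub z x y hz.ne]
  exact h.trans_le (le_max_right _ _)

end Balls

end P1

section BallKinds

variable {K : Type*} [NormedField K]

theorem isBallK_setOf_norm_sub_lt (x : K) {r : ℝ} (hr : 0 < r) :
    IsBallK {z : K | ‖z - x‖ < r} := by
  by_cases hv : r ∈ valueGroup K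
  · exact Or.inl ⟨x, r, hv, rfl⟩
  · refine Or.inr (Or.inr ⟨x, r, hr, hv, ?_⟩)
    simp only [(norm_ne_of_notMem_valueGroup hr hv _).le_iff_lt]

theorem isOpenBall_or_isIrrationalBall_iff {B : Set (P1 K)} :
    IsOpenBall B ∨ IsIrrationalBall B ↔
      (∃ x r, 0 < r ∧ B = P1.openBall x r) ∨ ∃ x r, 0 < r ∧ B = (P1.closedBall x r)ᶜ := by
  constructor
  · rintro ((⟨_, ⟨x, r, hr, rfl⟩, rfl⟩ | ⟨_, ⟨x, r, hr, rfl⟩, rfl⟩) |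
      (⟨_, ⟨x, r, hr, hv, rfl⟩, rfl⟩ | ⟨_, ⟨x, r, hr, -, rfl⟩, rfl⟩))
    · exact Or.inl ⟨x, r, pos_of_mem_valueGroup hr, rfl⟩
    · exact Or.inr ⟨x, r, pos_of_mem_valueGroup hr, rfl⟩
    · exact Or.inl ⟨x, r, hr, (P1.openBall_eq_closedBall x hr hv).symm⟩
    · exact Or.inr ⟨x, r, hr, rfl⟩
  · rintro (⟨x, r, hr, rfl⟩ | ⟨x, r, hr, rfl⟩) <;> by_cases hv : r ∈ valueGroup K
    · exact Or.inl (P1.isOpenBall_openBall x hv)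
    · rw [P1.openBall_eq_closedBall x hr hv]
      exact Or.inr (Or.inl ⟨_, ⟨x, r, hr, hv, rfl⟩, rfl⟩)
    · exact Or.inl (P1.isOpenBall_compl_closedBall x hv)
    · exact Or.inr (Or.inr ⟨_, ⟨x, r, hr, hv, rfl⟩, rfl⟩)

theorem isClosedBall_iff_isOpenBall_compl {B : Set (P1 K)} : IsClosedBall B ↔ IsOpenBall Bᶜ := by
  simp only [IsClosedBall, IsOpenBall, compl_eq_comm (x := B), eq_comm (a := B), compl_compl]
  exact or_comm

theorem isIrrationalBall_compl_iff {B : Set (P1 K)} :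
    IsIrrationalBall Bᶜ ↔ IsIrrationalBall B := by
  simp only [IsIrrationalBall, compl_eq_comm (x := B), eq_comm (a := B), compl_compl]
  exact or_comm

end BallKinds

/-! ### The uniform structure of the projective line -/

section CoverRel

variable {K : Type*} [NormedField K] {D D' E E' : Set (P1 K)}

theorem mem_coverRel_pair {p : P1 K × P1 K} :
    p ∈ coverRel {E, E'} ↔ p.1 ∈ E ∧ p.2 ∈ E ∨ p.1 ∈ E' ∧ p.2 ∈ E' := by
  rw [coverRel, biUnion_pair]
  rfl

theorem coverRel_pair_subset (h : E ⊆ D) (h' : E' ⊆ D') :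
    coverRel {E, E'} ⊆ coverRel {D, D'} := fun p => by
  rw [mem_coverRel_pair, mem_coverRel_pair]
  exact Or.imp (And.imp (@h _) (@h _)) (And.imp (@h' _) (@h' _))

theorem coverRel_pair_mem_prod_iff {F : Filter (P1 K)} :
    coverRel {E, E'} ∈ F ×ˢ F ↔ E ∈ F ∨ E' ∈ F := by
  rw [coverRel, biUnion_pair]
  constructor
  · rintro h
    obtain ⟨A, hA, hsub⟩ := mem_prod_same_iff.1 h
    by_cases hAE : A ⊆ E
    · exact Or.inl (mem_of_superset hA hAE)
    · obtain ⟨a, haA, haE⟩ := not_subset.1 hAE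
      exact Or.inr (mem_of_superset hA fun b hb =>
        ((hsub (mk_mem_prod haA hb)).resolve_left fun hab => haE hab.1).2)
  · rintro (h | h)
    · exact mem_of_superset (prod_mem_prod h h) subset_union_left
    · exact mem_of_superset (prod_mem_prod h h) subset_union_right

theorem isAffinoidCover_pair (hE : IsOpenBall E) (hE' : IsOpenBall E') (h : E ∪ E' = univ) :
    IsAffinoidCover {E, E'} :=
  ⟨toFinite _, by rintro _ (rfl | rfl); exacts [hE.isOpenAffinoid, hE'.isOpenAffinoid],
    by rw [sUnion_pair, h]⟩

theorem lt_norm_sub_of_compl_closedBall_union_compl_closedBall {x y : K} {r s : ℝ} (hs : 0 ≤ s)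
    (h : (P1.closedBall x r)ᶜ ∪ (P1.closedBall y s)ᶜ = univ) : r < ‖x - y‖ := by
  have hy : P1.of y ∉ P1.closedBall x r := (h.ge (mem_univ (P1.of y))).resolve_right
    (not_not.2 (P1.of_mem_closedBall.2 (by simpa using hs)))
  rwa [P1.of_mem_closedBall, not_le, norm_sub_rev] at hy

variable [IsUltrametricDist K]

theorem IsAffinoidCover.exists_iInter_coverRel_subset [Infinite (ResField K)]
    {C : Set (Set (P1 K))} (hC : IsAffinoidCover C) :
    ∃ T : Set (Set (P1 K) × Set (P1 K)), T.Finite ∧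
      (∀ p ∈ T, IsOpenBall p.1 ∧ IsOpenBall p.2 ∧ p.1 ∪ p.2 = univ) ∧
      ⋂ p ∈ T, coverRel {p.1, p.2} ⊆ coverRel C := by
  obtain ⟨hfin, haff, hcov⟩ := hC
  choose! s hs hball hinter using haff
  have hball' : ∀ D ∈ ⋃ Y ∈ C, s Y, IsOpenBall D := fun D hD =>
    let ⟨Y, hY, hDY⟩ := mem_iUnion₂.1 hD
    hball Y hY D hDY
  refine ⟨{p ∈ (⋃ Y ∈ C, s Y) ×ˢ (⋃ Y ∈ C, s Y) | p.1 ∪ p.2 = univ},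
    ((hfin.biUnion hs).prod (hfin.biUnion hs)).subset (sep_subset _ _),
    fun p hp => ⟨hball' _ hp.1.1, hball' _ hp.1.2, hp.2⟩, fun q hq => ?_⟩
  by_contra hqC
  have hmiss : ∀ Y ∈ C, ∃ D ∈ s Y, ¬ (q.1 ∈ D ∧ q.2 ∈ D) := by
    intro Y hY
    by_contra! hall
    refine hqC (mem_biUnion hY ?_)
    rw [hinter Y hY]
    exact ⟨fun D hD => (hall D hD).1, fun D hD => (hall D hD).2⟩
  choose! d hd hqd using hmiss
  have hdS : ∀ Y ∈ C, d Y ∈ ⋃ Y ∈ C, s Y := fun Y hY => mem_biUnion hY (hd Y hY)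
  have hdcov : ⋃₀ (d '' C) = univ := by
    rw [sUnion_image, ← univ_subset_iff, ← hcov, sUnion_eq_biUnion]
    exact biUnion_mono Subset.rfl fun Y hY =>
      (hinter Y hY).le.trans (sInter_subset_of_mem (hd Y hY))
  obtain ⟨_, ⟨Y, hY, rfl⟩, _, ⟨Y', hY', rfl⟩, hYY'⟩ := exists_pair_cover (hfin.image d)
    (forall_mem_image.2 fun Y hY => hball' _ (hdS Y hY)) hdcov
  rcases mem_coverRel_pair.1 (mem_iInter₂.1 hq (d Y, d Y') ⟨⟨hdS Y hY, hdS Y' hY'⟩, hYY'⟩)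
    with h | h
  exacts [hqd Y hY h, hqd Y' hY' h]

theorem lt_and_openBall_subset_of_union_eq_univ {x y : K} {r s : ℝ} (hr : r ∈ valueGroup K)
    (h : P1.openBall x s ∪ (P1.closedBall y r)ᶜ = univ) :
    r < s ∧ P1.openBall y s ⊆ P1.openBall x s := by
  have hball : ∀ z, ‖z - y‖ ≤ r → ‖z - x‖ < s := fun z hz =>
    P1.of_mem_openBall.1 ((h.ge (mem_univ (P1.of z))).resolve_right
      (not_not.2 (P1.of_mem_closedBall.2 hz)))
  have hyx : ‖y - x‖ < s := hball y (by simpa using (pos_of_mem_valueGroup hr).le)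
  obtain ⟨z, hz⟩ := exists_norm_sub_eq_of_mem_valueGroup y hr
  refine ⟨?_, P1.openBall_subset_openBall_of_norm_sub_lt hyx⟩
  rw [← hz]
  exact (norm_sub_le_max' z x y).trans_lt
    (max_lt (hball z hz.le) (norm_sub_rev y x ▸ hyx))

theorem exists_concentric_coverRel_subset (hE : IsOpenBall E) (hE' : IsOpenBall E')
    (h : E ∪ E' = univ) : ∃ (x : K) (r s : ℝ), 0 < r ∧ r < s ∧
      coverRel {P1.openBall x s, (P1.closedBall x r)ᶜ} ⊆ coverRel {E, E'} := by
  obtain ⟨_, ⟨a, s, -, rfl⟩, rfl⟩ | ⟨_, ⟨a, s, hs, rfl⟩, rfl⟩ := hE <;>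
    obtain ⟨_, ⟨b, r, -, rfl⟩, rfl⟩ | ⟨_, ⟨b, r, hr, rfl⟩, rfl⟩ := hE'
  · exact ((h.ge (mem_univ (P1.infty K))).elim infty_notMem_image infty_notMem_image).elim
  · obtain ⟨hrs, hsub⟩ := lt_and_openBall_subset_of_union_eq_univ hr h
    exact ⟨b, r, s, pos_of_mem_valueGroup hr, hrs, coverRel_pair_subset hsub Subset.rfl⟩
  · obtain ⟨hsr, hsub⟩ := lt_and_openBall_subset_of_union_eq_univ hs ((union_comm _ _).trans h)
    rw [pair_comm (P1.of '' _)ᶜ]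
    exact ⟨a, s, r, pos_of_mem_valueGroup hs, hsr, coverRel_pair_subset hsub Subset.rfl⟩
  · have hsab := lt_norm_sub_of_compl_closedBall_union_compl_closedBall
      (pos_of_mem_valueGroup hr).le h
    have hrab := lt_norm_sub_of_compl_closedBall_union_compl_closedBall
      (pos_of_mem_valueGroup hs).le ((union_comm _ _).trans h)
    rw [norm_sub_rev] at hrab
    rw [pair_comm]
    exact ⟨a, s, ‖a - b‖, pos_of_mem_valueGroup hs, hsab, coverRel_pair_subset
      (P1.openBall_norm_sub_subset_compl_closedBall hrab) Subset.rfl⟩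

end CoverRel

namespace P1

section Uniformity

variable {K : Type*} [DenselyNormedField K] [IsUltrametricDist K] [Infinite (ResField K)]

theorem coverRel_concentric_mem_uniformity (x : K) {r s : ℝ} (hr : 0 < r) (hrs : r < s) :
    coverRel {openBall x s, (closedBall x r)ᶜ} ∈ 𝓤 (P1 K) := by
  obtain ⟨u, hu, hru, hus⟩ := exists_mem_valueGroup_between (K := K) hrs (hr.trans hrs)
  obtain ⟨t, ht, hrt, htu⟩ := exists_mem_valueGroup_between (K := K) hru (hr.trans hru)
  exact mem_uniformity_P1.2 ⟨_, isAffinoidCover_pair (isOpenBall_openBall x hu)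
    (isOpenBall_compl_closedBall x ht) (openBall_union_compl_closedBall x htu),
    coverRel_pair_subset (openBall_subset_openBall x hus.le)
      (compl_subset_compl.2 (closedBall_subset_closedBall x hrt.le))⟩

theorem uniformity_eq_iInf : 𝓤 (P1 K) = ⨅ (x : K) (r : ℝ) (s : ℝ) (_ : 0 < r) (_ : r < s),
    𝓟 (coverRel {openBall x s, (closedBall x r)ᶜ}) := by
  refine le_antisymm ?_ fun V hV => ?_
  · simp only [le_iInf_iff, le_principal_iff]
    exact fun x r s hr hrs => coverRel_concentric_mem_uniformity x hr hrs
  · obtain ⟨C, hC, hCV⟩ := mem_uniformity_P1.1 hV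
    obtain ⟨T, hT, hball, hTC⟩ := hC.exists_iInter_coverRel_subset
    refine mem_of_superset ((biInter_mem hT).2 fun p hp => ?_) (hTC.trans hCV)
    obtain ⟨x, r, s, hr, hrs, hsub⟩ :=
      exists_concentric_coverRel_subset (hball p hp).1 (hball p hp).2.1 (hball p hp).2.2
    exact le_principal_iff.1 (iInf_le_of_le x <| iInf_le_of_le r <| iInf_le_of_le s <|
      iInf₂_le_of_le hr hrs (principal_mono.2 hsub))

theorem cauchy_iff {F : Filter (P1 K)} : Cauchy F ↔
    F.NeBot ∧ ∀ (x : K) (r s : ℝ), 0 < r → r < s →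
      openBall x s ∈ F ∨ (closedBall x r)ᶜ ∈ F := by
  simp only [Cauchy, uniformity_eq_iInf, le_iInf_iff, le_principal_iff,
    coverRel_pair_mem_prod_iff]

end Uniformity

end P1

/-! ### Points and balls of the tree -/

namespace KTree

section Sup

variable {K : Type*} [NormedField K] [IsUltrametricDist K]

theorem sup_ofPoint_mk (x a : K) (r : ℝ≥0) :
    sup (ofPoint x) (BallTree.mk a r : KTree K) = max (r : ℝ) ‖x - a‖ := by
  have h : (BallTree.ofPoint x).sup (BallTree.mk a r) = max (max ((0 : ℝ≥0) : ℝ) r) (dist x a) :=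
    rfl
  rw [ofPoint, sup_coe, h, NNReal.coe_zero, max_eq_right r.coe_nonneg, dist_eq_norm]

theorem sup_ofPoint_ofPoint (x y : K) : sup (ofPoint x) (ofPoint y) = ‖x - y‖ :=
  (sup_ofPoint_mk x y 0).trans (max_eq_right (norm_nonneg _))

theorem diam_mk (a : K) (r : ℝ≥0) : diam (BallTree.mk a r : KTree K) = r := diam_coe _

theorem diam_le_sup_right (S T : KTree K) : diam T ≤ sup S T := by
  rw [sup_comm]
  exact diam_le_sup T S

theorem continuous_sup_right (S : KTree K) : Continuous (sup S) :=
  continuous_sup.comp (Continuous.prodMk_right S)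

theorem sup_ofPoint_le_max (x y : K) (S : KTree K) :
    sup (ofPoint x) S ≤ max ‖x - y‖ (sup (ofPoint y) S) := by
  rw [← sup_ofPoint_ofPoint]
  exact sup_ultra _ _ _

theorem norm_sub_le_max_sup (x y : K) (S : KTree K) :
    ‖x - y‖ ≤ max (sup (ofPoint x) S) (sup (ofPoint y) S) := by
  rw [← sup_ofPoint_ofPoint, sup_comm (ofPoint y)]
  exact sup_ultra _ _ _

theorem eq_of_sup_le {S T : KTree K} (h : sup S T ≤ diam S) (h' : sup S T ≤ diam T) :
    S = T := by
  refine dist_le_zero.1 ?_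
  rw [dist_eq]
  linarith

theorem exists_sup_ofPoint_lt (S : KTree K) {r : ℝ} (hr : diam S < r) :
    ∃ a : K, sup (ofPoint a) S < r := by
  have hopen : IsOpen {T : KTree K | sup S T < r} :=
    isOpen_lt (continuous_sup_right S) continuous_const
  obtain ⟨T, hT⟩ := UniformSpace.Completion.denseRange_coe.exists_mem_open hopen
    ⟨S, (sup_self S).trans_lt hr⟩
  obtain ⟨⟨a, t⟩, rfl⟩ := Quotient.exists_rep T
  change sup S (BallTree.mk a t : KTree K) < r at hT
  refine ⟨a, (sup_ultra _ (BallTree.mk a t : KTree K) _).trans_lt (max_lt ?_ ?_)⟩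
  · rw [sup_ofPoint_mk, sub_self, norm_zero, max_eq_left t.coe_nonneg, ← diam_mk a t]
    exact (diam_le_sup_right S _).trans_lt hT
  · rwa [sup_comm]

theorem sup_le_diam_of_forall_sup_ofPoint_eq {S T : KTree K}
    (h : ∀ x : K, sup (ofPoint x) S = sup (ofPoint x) T) : sup S T ≤ diam S := by
  refine le_of_forall_gt fun r hr => ?_
  obtain ⟨a, ha⟩ := exists_sup_ofPoint_lt S hr
  have hST := sup_ultra S (ofPoint a) T
  rw [sup_comm S (ofPoint a), ← h a, max_self] at hST
  exact hST.trans_lt ha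

theorem ext_sup {S T : KTree K} (h : ∀ x : K, sup (ofPoint x) S = sup (ofPoint x) T) :
    S = T :=
  eq_of_sup_le (sup_le_diam_of_forall_sup_ofPoint_eq h)
    (sup_comm S T ▸ sup_le_diam_of_forall_sup_ofPoint_eq fun x => (h x).symm)

theorem eq_mk_of_sup_eq_diam {S : KTree K} {a : K} (h : sup (ofPoint a) S = diam S) :
    S = (BallTree.mk a (diam S).toNNReal : KTree K) := by
  have hd : ((diam S).toNNReal : ℝ) = diam S := Real.coe_toNNReal _ (diam_nonneg S)
  have hsup := sup_ultra S (ofPoint a) (BallTree.mk a (diam S).toNNReal : KTree K)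
  rw [sup_comm S (ofPoint a), sup_ofPoint_mk, h, sub_self, norm_zero, hd,
    max_eq_left (diam_nonneg S), max_self] at hsup
  exact eq_of_sup_le hsup (by rwa [diam_mk, hd])

theorem cauchySeq_of_tendsto_diam {u : ℕ → BallTree K} {d : ℝ}
    (hsup : ∀ m n, (u m).sup (u n) = max (u m).diam (u n).diam)
    (hd : Tendsto (fun n => (u n).diam) atTop (𝓝 d)) : CauchySeq u := by
  refine cauchySeq_iff_tendsto_dist_atTop_0.2 ?_
  have hdiam := (cauchySeq_iff_tendsto_dist_atTop_0.1 hd.cauchySeq).div_const 2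
  rw [zero_div] at hdiam
  refine hdiam.congr fun p => ?_
  rw [BallTree.dist_def, hsup, Real.dist_eq]
  rcases le_total (u p.1).diam (u p.2).diam with h | h
  · rw [abs_of_nonpos (sub_nonpos.2 h), max_eq_right h]
    ring
  · rw [abs_of_nonneg (sub_nonneg.2 h), max_eq_left h]
    ring

theorem exists_forall_isGLB_sup {C : Set (BallTree K)} (hne : C.Nonempty)
    (hC : ∀ S ∈ C, ∀ T ∈ C, S.sup T = max S.diam T.diam) :
    ∃ S : KTree K, ∀ U, IsGLB ((fun T : BallTree K => sup U T) '' C) (sup U S) := by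
  have hbdd : BddBelow (BallTree.diam '' C) :=
    ⟨0, forall_mem_image.2 fun T _ => BallTree.diam_nonneg T⟩
  obtain ⟨v, -, hv, hvC⟩ := exists_seq_tendsto_sInf (hne.image BallTree.diam) hbdd
  choose u huC huv using hvC
  obtain rfl : (fun n => (u n).diam) = v := funext huv
  have hcauchy : CauchySeq fun n => (u n : KTree K) :=
    (UniformSpace.Completion.uniformContinuous_coe _).comp_cauchySeq
      (cauchySeq_of_tendsto_diam (fun m n => hC _ (huC m) _ (huC n)) hv)
  obtain ⟨S, hS⟩ := cauchySeq_tendsto_of_complete hcauchy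
  have hlim (U : KTree K) : Tendsto (fun n => sup U (u n : KTree K)) atTop (𝓝 (sup U S)) :=
    ((continuous_sup_right U).tendsto S).comp hS
  refine ⟨S, fun U => ⟨forall_mem_image.2 fun T hT => ?_, fun b hb =>
    ge_of_tendsto' (hlim U) fun n => hb (mem_image_of_mem _ (huC n))⟩⟩
  have hTU : T.diam ≤ sup U T := (diam_coe T).ge.trans (diam_le_sup_right U T)
  have hle (n : ℕ) : sup U (u n : KTree K) ≤ max (sup U T) (u n).diam := by
    have h := sup_ultra U (T : KTree K) (u n)
    rwa [sup_coe, hC T hT _ (huC n), ← max_assoc, max_eq_left hTU] at h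
  exact (le_of_tendsto_of_tendsto' (hlim U) (tendsto_const_nhds.max hv) hle).trans
    (max_le le_rfl ((csInf_le hbdd (mem_image_of_mem _ hT)).trans hTU))

end Sup

end KTree

namespace ProjTree

section Balls

variable {K : Type*} [NormedField K] [IsUltrametricDist K]

/-- The set `{sup {x, S} < r}` in the projective tree, for an arbitrary real `r`: an open ball when
`r > 0`. -/
def openBall (x : K) (r : ℝ) : Set (ProjTree K) := of '' {S | KTree.sup (KTree.ofPoint x) S < r}

/-- The set `{sup {x, S} ≤ r}` in the projective tree, for an arbitrary real `r`: a closed ball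
when `r > 0`. -/
def closedBall (x : K) (r : ℝ) : Set (ProjTree K) :=
  of '' {S | KTree.sup (KTree.ofPoint x) S ≤ r}

variable {x : K} {r : ℝ} {S : KTree K} {D : Set (ProjTree K)}

theorem of_injective : Function.Injective (of : KTree K → ProjTree K) :=
  fun _ _ h => by injection h

theorem of_mem_openBall : of S ∈ openBall x r ↔ KTree.sup (KTree.ofPoint x) S < r :=
  of_injective.mem_set_image

theorem of_mem_closedBall : of S ∈ closedBall x r ↔ KTree.sup (KTree.ofPoint x) S ≤ r :=
  of_injective.mem_set_image

theorem infty_notMem_openBall : infty ∉ openBall x r := by rintro ⟨S, -, ⟨⟩⟩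

theorem infty_notMem_closedBall : infty ∉ closedBall x r := by rintro ⟨S, -, ⟨⟩⟩

theorem closedBall_subset_openBall (x : K) {s : ℝ} (h : r < s) : closedBall x r ⊆ openBall x s :=
  image_mono fun _ hS => lt_of_le_of_lt hS h

theorem openBall_subset_closedBall (x : K) (r : ℝ) : openBall x r ⊆ closedBall x r :=
  image_mono fun _ => le_of_lt (α := ℝ)

theorem exists_lt_mem_closedBall {P : ProjTree K} (h : P ∈ openBall x r) :
    ∃ s, 0 < s ∧ s < r ∧ P ∈ closedBall x s := by
  obtain ⟨S, hS : _ < r, rfl⟩ := h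
  obtain ⟨s, hSs, hsr⟩ := exists_between hS
  exact ⟨s, (sup_nonneg _ _).trans_lt hSs, hsr, of_mem_closedBall.2 hSs.le⟩

theorem exists_gt_notMem_openBall {P : ProjTree K} (h : P ∉ closedBall x r) :
    ∃ s, r < s ∧ P ∉ openBall x s := by
  cases P with
  | infty => exact ⟨r + 1, lt_add_one r, infty_notMem_openBall⟩
  | of S =>
    rw [of_mem_closedBall, not_le] at h
    exact ⟨_, h, fun hS => (of_mem_openBall.1 hS).false⟩

theorem isOpenBall_iff :
    IsOpenBall D ↔ (∃ x r, 0 < r ∧ D = openBall x r) ∨ ∃ x r, 0 < r ∧ D = (closedBall x r)ᶜ := by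
  constructor
  · rintro (⟨_, ⟨x, r, hr, rfl⟩, rfl⟩ | ⟨_, ⟨x, r, hr, rfl⟩, rfl⟩)
    · exact Or.inl ⟨x, r, hr, rfl⟩
    · exact Or.inr ⟨x, r, hr, rfl⟩
  · rintro (⟨x, r, hr, rfl⟩ | ⟨x, r, hr, rfl⟩)
    · exact Or.inl ⟨_, ⟨x, r, hr, rfl⟩, rfl⟩
    · exact Or.inr ⟨_, ⟨x, r, hr, rfl⟩, rfl⟩

theorem isClosedBall_iff_isOpenBall_compl : IsClosedBall D ↔ IsOpenBall Dᶜ := by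
  simp only [IsClosedBall, IsOpenBall, compl_eq_comm (x := D), eq_comm (a := D), compl_compl]
  exact or_comm

theorem of_mem_trace {z : K} : P1.of z ∈ trace D ↔ of (KTree.ofPoint z) ∈ D := by
  constructor
  · rintro (⟨x, h, hx⟩ | ⟨h, -⟩)
    · rwa [P1.of_injective h]
    · exact absurd h (P1.of_ne_infty z)
  · exact fun h => Or.inl ⟨z, rfl, h⟩

theorem infty_mem_trace : P1.infty K ∈ trace D ↔ infty ∈ D := by
  constructor
  · rintro (⟨x, h, -⟩ | ⟨-, h⟩)
    · exact absurd h.symm (P1.of_ne_infty x)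
    · exact h
  · exact fun h => Or.inr ⟨rfl, h⟩

theorem trace_compl (D : Set (ProjTree K)) : trace Dᶜ = (trace D)ᶜ := by
  ext p
  rcases P1.eq_infty_or_of p with rfl | ⟨x, rfl⟩
  · rw [mem_compl_iff, infty_mem_trace, infty_mem_trace, mem_compl_iff]
  · rw [mem_compl_iff, of_mem_trace, of_mem_trace, mem_compl_iff]

theorem trace_openBall (x : K) (r : ℝ) : trace (openBall x r) = P1.openBall x r := by
  ext p
  rcases P1.eq_infty_or_of p with rfl | ⟨z, rfl⟩
  · rw [infty_mem_trace]
    exact iff_of_false infty_notMem_openBall P1.infty_notMem_openBall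
  · rw [of_mem_trace, of_mem_openBall, P1.of_mem_openBall, KTree.sup_ofPoint_ofPoint,
      norm_sub_rev]

theorem trace_closedBall (x : K) (r : ℝ) : trace (closedBall x r) = P1.closedBall x r := by
  ext p
  rcases P1.eq_infty_or_of p with rfl | ⟨z, rfl⟩
  · rw [infty_mem_trace]
    exact iff_of_false infty_notMem_closedBall P1.infty_notMem_closedBall
  · rw [of_mem_trace, of_mem_closedBall, P1.of_mem_closedBall, KTree.sup_ofPoint_ofPoint,
      norm_sub_rev]

theorem exists_isOpenBall_trace_eq_iff {B : Set (P1 K)} :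
    (∃ D, IsOpenBall D ∧ trace D = B) ↔ BerkLine.IsOpenBall B ∨ IsIrrationalBall B := by
  rw [isOpenBall_or_isIrrationalBall_iff]
  constructor
  · rintro ⟨D, hD, rfl⟩
    rcases isOpenBall_iff.1 hD with ⟨x, r, hr, rfl⟩ | ⟨x, r, hr, rfl⟩
    · exact Or.inl ⟨x, r, hr, trace_openBall x r⟩
    · exact Or.inr ⟨x, r, hr, by rw [trace_compl, trace_closedBall]⟩
  · rintro (⟨x, r, hr, rfl⟩ | ⟨x, r, hr, rfl⟩)
    · exact ⟨_, isOpenBall_iff.2 (Or.inl ⟨x, r, hr, rfl⟩), trace_openBall x r⟩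
    · exact ⟨_, isOpenBall_iff.2 (Or.inr ⟨x, r, hr, rfl⟩),
        by rw [trace_compl, trace_closedBall]⟩

theorem exists_isClosedBall_trace_eq_iff {B : Set (P1 K)} :
    (∃ D, IsClosedBall D ∧ trace D = B) ↔ BerkLine.IsClosedBall B ∨ IsIrrationalBall B := by
  rw [BerkLine.isClosedBall_iff_isOpenBall_compl, ← isIrrationalBall_compl_iff,
    ← exists_isOpenBall_trace_eq_iff]
  constructor
  · rintro ⟨D, hD, rfl⟩
    exact ⟨Dᶜ, isClosedBall_iff_isOpenBall_compl.1 hD, trace_compl D⟩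
  · rintro ⟨D, hD, hB⟩
    exact ⟨Dᶜ, isClosedBall_iff_isOpenBall_compl.2 (by rwa [compl_compl]),
      by rw [trace_compl, hB, compl_compl]⟩

end Balls

section Chordal

variable {K : Type*} [NormedField K] [IsUltrametricDist K]

theorem lipschitzWith_csup_left (Q : ProjTree K) : LipschitzWith 2 fun P => csup P Q := by
  refine LipschitzWith.of_le_add_mul _ fun P R => ?_
  have hdist : dist P R = csup P R - (csup P P + csup R R) / 2 := chordal_eq P R
  have hP := csup_self_le P R
  have hR := csup_self_le R P
  have hQ := csup_self_le R Q
  rw [csup_comm R P] at hR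
  rw [NNReal.coe_ofNat]
  rcases le_max_iff.1 (csup_ultra P R Q) with h | h <;> linarith

theorem mem_openBall_iff_csup {x : K} {r : ℝ} {P : ProjTree K} : P ∈ openBall x r ↔
    height (KTree.ofPoint x) * csup P (of (KTree.ofPoint x)) < r * csup P infty := by
  cases P with
  | infty => simp [csup, infty_notMem_openBall, height_pos _ |>.ne']
  | of S =>
    have hx := height_pos (KTree.ofPoint x)
    have hS := height_pos S
    rw [of_mem_openBall, KTree.sup_comm]
    simp only [csup]
    field_simp

theorem mem_closedBall_iff_csup {x : K} {r : ℝ} {P : ProjTree K} : P ∈ closedBall x r ↔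
    height (KTree.ofPoint x) * csup P (of (KTree.ofPoint x)) ≤ r * csup P infty := by
  cases P with
  | infty => simp [csup, infty_notMem_closedBall, height_pos _ |>.ne']
  | of S =>
    have hx := height_pos (KTree.ofPoint x)
    have hS := height_pos S
    rw [of_mem_closedBall, KTree.sup_comm]
    simp only [csup]
    field_simp

theorem inv_le_csup_infty {x : K} {r : ℝ} {P : ProjTree K} (hP : P ∈ closedBall x r) :
    (max r (height (KTree.ofPoint x)))⁻¹ ≤ csup P infty := by
  obtain ⟨S, hS, rfl⟩ := hP
  have hle : height S ≤ max r (height (KTree.ofPoint x)) :=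
    (height_le S (KTree.ofPoint x)).trans
      (max_le_max_right _ ((KTree.sup_comm _ _).trans_le hS))
  exact (inv_anti₀ (height_pos S) hle).trans_eq (one_div _).symm

theorem eventually_mem_openBall_of_mem_closedBall (x : K) {r s : ℝ} (hrs : r < s) :
    ∀ᶠ p in 𝓤 (ProjTree K), p.1 ∈ closedBall x r → p.2 ∈ openBall x s := by
  let h := height (KTree.ofPoint x)
  let f (P : ProjTree K) : ℝ := s * csup P infty - h * csup P (of (KTree.ofPoint x))
  have hf : UniformContinuous f :=
    ((lipschitzWith_csup_left _).uniformContinuous.const_mul' s).sub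
      ((lipschitzWith_csup_left _).uniformContinuous.const_mul' h)
  have hc : 0 < (s - r) * (max r h)⁻¹ :=
    mul_pos (sub_pos.2 hrs) (inv_pos.2 ((height_pos _).trans_le (le_max_right _ _)))
  filter_upwards [hf (Metric.dist_mem_uniformity hc)] with p hp hpr
  have hfp : (s - r) * (max r h)⁻¹ ≤ f p.1 := calc
    (s - r) * (max r h)⁻¹ ≤ (s - r) * csup p.1 infty :=
      mul_le_mul_of_nonneg_left (inv_le_csup_infty hpr) (sub_pos.2 hrs).le
    _ = s * csup p.1 infty - r * csup p.1 infty := sub_mul _ _ _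
    _ ≤ f p.1 := sub_le_sub_left (mem_closedBall_iff_csup.1 hpr) _
  have hfp' : f p.1 - f p.2 < (s - r) * (max r h)⁻¹ := (le_abs_self _).trans_lt hp
  exact mem_openBall_iff_csup.2 (sub_pos.1 (by linarith : 0 < f p.2))

end Chordal

end ProjTree

/-! ### The filter of a point of the tree -/

section NearSphere

variable {K : Type*} [NormedField K]

/-- The filter of the points of `K` whose distance to `x` is close to `r` but different from `r`.
Keeping off the sphere of radius `r` makes `‖z - y‖` tend to `max r ‖y - x‖` for every `y`, so that
this filter represents the point `[x, r]` of the tree. -/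
def nearSphere (x : K) (r : ℝ) : Filter K := comap (fun z => ‖z - x‖) (𝓝[≠] r)

theorem tendsto_norm_sub_nearSphere [IsUltrametricDist K] (x y : K) (r : ℝ) :
    Tendsto (fun z => ‖z - y‖) (nearSphere x r) (𝓝 (max r ‖y - x‖)) := by
  have hx : Tendsto (fun z => ‖z - x‖) (nearSphere x r) (𝓝[≠] r) := tendsto_comap
  have hne : ∀ᶠ z in nearSphere x r, ‖z - x‖ ≠ ‖x - y‖ :=
    hx.eventually (nhdsNE_le_cofinite r (finite_singleton _).compl_mem_cofinite)
  refine ((hx.mono_right nhdsWithin_le_nhds).max tendsto_const_nhds).congr' ?_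
  filter_upwards [hne] with z hz
  rw [norm_sub_rev y x, IsUltrametricDist.norm_sub_eq_max_of_norm_sub_ne_norm_sub z x y hz]

end NearSphere

section NearSphereDense

variable {K : Type*} [DenselyNormedField K] (x : K) {r : ℝ}

theorem frequently_norm_sub_lt_nearSphere (hr : 0 < r) :
    ∃ᶠ z in nearSphere x r, ‖z - x‖ < r := by
  refine frequently_comap.2 (Frequently.filter_mono ?_ (nhdsLT_le_nhdsNE r))
  refine ((frequently_mem_valueGroup_nhdsLT (K := K) hr).and_eventually
    self_mem_nhdsWithin).mono fun t ⟨ht, htr⟩ => ?_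
  obtain ⟨z, rfl⟩ := exists_norm_sub_eq_of_mem_valueGroup x ht
  exact ⟨z, rfl, htr⟩

theorem frequently_lt_norm_sub_nearSphere (hr : 0 ≤ r) :
    ∃ᶠ z in nearSphere x r, r < ‖z - x‖ := by
  refine frequently_comap.2 (Frequently.filter_mono ?_ (nhdsGT_le_nhdsNE r))
  refine ((frequently_mem_valueGroup_nhdsGT (K := K) hr).and_eventually
    self_mem_nhdsWithin).mono fun t ⟨ht, hrt⟩ => ?_
  obtain ⟨z, rfl⟩ := exists_norm_sub_eq_of_mem_valueGroup x ht
  exact ⟨z, rfl, hrt⟩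

theorem nearSphere_neBot (hr : 0 ≤ r) : (nearSphere x r).NeBot :=
  frequently_true_iff_neBot _ |>.1 <|
    (frequently_lt_norm_sub_nearSphere x hr).mono fun _ _ => trivial

end NearSphereDense

theorem BallTree.sup_mk_mk_of_openBall_mem {K : Type*} [NormedField K] [IsUltrametricDist K]
    {F : Filter (P1 K)} [F.NeBot] {x y : K} {r s : ℝ≥0}
    (hx : P1.openBall x r ∈ F) (hy : P1.openBall y s ∈ F) :
    (mk x r).sup (mk y s) = max (mk x r).diam (mk y s).diam := by
  obtain ⟨_, ⟨z, hzx, rfl⟩, hzy⟩ := Filter.nonempty_of_mem (inter_mem hx hy)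
  refine max_eq_left (dist_eq_norm x y ▸ (norm_sub_le_max' x z y).trans (max_le_max ?_ ?_))
  · exact norm_sub_rev x z ▸ le_of_lt hzx
  · exact (P1.of_mem_openBall.1 hzy).le

namespace ProjTree

section Filter

variable {K : Type*} [NormedField K] [IsUltrametricDist K] {P : ProjTree K} {x : K} {r : ℝ}

/-- The filter on the projective line generated by the traces of the open balls that contain a
given point of the projective tree. It is the image of that point in the compactification. -/
def filter (P : ProjTree K) : Filter (P1 K) :=
  Filter.generate {B | ∃ D, IsOpenBall D ∧ P ∈ D ∧ trace D = B}

theorem le_filter_iff {F : Filter (P1 K)} :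
    F ≤ P.filter ↔ (∀ x r, 0 < r → P ∈ openBall x r → P1.openBall x r ∈ F) ∧
      ∀ x r, 0 < r → P ∉ closedBall x r → (P1.closedBall x r)ᶜ ∈ F := by
  rw [filter, le_generate_iff]
  constructor
  · refine fun h => ⟨fun x r hr hP => ?_, fun x r hr hP => ?_⟩
    · exact h ⟨_, isOpenBall_iff.2 (Or.inl ⟨x, r, hr, rfl⟩), hP, trace_openBall x r⟩
    · exact h ⟨_, isOpenBall_iff.2 (Or.inr ⟨x, r, hr, rfl⟩), hP,
        by rw [trace_compl, trace_closedBall]⟩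
  · rintro ⟨hopen, hclosed⟩ _ ⟨D, hD, hP, rfl⟩
    rcases isOpenBall_iff.1 hD with ⟨x, r, hr, rfl⟩ | ⟨x, r, hr, rfl⟩
    · rw [trace_openBall]
      exact hopen x r hr hP
    · rw [trace_compl, trace_closedBall]
      exact hclosed x r hr hP

theorem openBall_mem_filter (hr : 0 < r) (h : P ∈ openBall x r) : P1.openBall x r ∈ P.filter :=
  (le_filter_iff.1 le_rfl).1 x r hr h

theorem compl_closedBall_mem_filter (hr : 0 < r) (h : P ∉ closedBall x r) :
    (P1.closedBall x r)ᶜ ∈ P.filter :=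
  (le_filter_iff.1 le_rfl).2 x r hr h

theorem pure_infty_le_filter : pure (P1.infty K) ≤ (infty : ProjTree K).filter :=
  le_filter_iff.2 ⟨fun _ _ _ h => absurd h infty_notMem_openBall,
    fun _ _ _ _ => P1.infty_notMem_closedBall⟩

theorem map_nearSphere_le_filter (a : K) (t : ℝ≥0) :
    map P1.of (nearSphere a t) ≤ (of (BallTree.mk a t : KTree K)).filter := by
  refine le_filter_iff.2 ⟨fun x r _ h => ?_, fun x r _ h => ?_⟩
  · rw [of_mem_openBall, KTree.sup_ofPoint_mk] at h
    exact mem_map.2 (((tendsto_norm_sub_nearSphere a x t).eventually_lt_const h).mono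
      fun z hz => P1.of_mem_openBall.2 hz)
  · rw [of_mem_closedBall, KTree.sup_ofPoint_mk, not_le] at h
    exact mem_map.2 (((tendsto_norm_sub_nearSphere a x t).eventually_const_lt h).mono
      fun z hz hz' => (P1.of_mem_closedBall.1 hz').not_gt hz)

theorem bind_filter_le_filter (S : KTree K) :
    ((𝓝 S).bind fun T => (of T).filter) ≤ (of S).filter := by
  refine le_filter_iff.2 ⟨fun x r hr h => mem_bind'.2 ?_, fun x r hr h => mem_bind'.2 ?_⟩
  · have hS := ((KTree.continuous_sup_right _).tendsto S).eventually_lt_const (of_mem_openBall.1 h)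
    exact hS.mono fun T hT => openBall_mem_filter hr (of_mem_openBall.2 hT)
  · rw [of_mem_closedBall, not_le] at h
    have hS := ((KTree.continuous_sup_right _).tendsto S).eventually_const_lt h
    exact hS.mono fun T hT => compl_closedBall_mem_filter hr
      fun hT' => (of_mem_closedBall.1 hT').not_gt hT

theorem eventually_coverRel_mem_prod_filter (x : K) {s : ℝ} (hr : 0 < r) (hrs : r < s) :
    ∀ᶠ p in 𝓤 (ProjTree K),
      coverRel {P1.openBall x s, (P1.closedBall x r)ᶜ} ∈ p.1.filter ×ˢ p.2.filter := by
  obtain ⟨t, hrt, hts⟩ := exists_between hrs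
  filter_upwards [eventually_mem_openBall_of_mem_closedBall x hts,
    tendsto_swap_uniformity.eventually (eventually_mem_openBall_of_mem_closedBall x hrt)]
    with p hp hp'
  rw [coverRel, biUnion_pair]
  by_cases hpt : p.1 ∈ closedBall x t
  · have hs := hr.trans hrs
    exact mem_of_superset (prod_mem_prod
      (openBall_mem_filter hs (closedBall_subset_openBall x hts hpt))
      (openBall_mem_filter hs (hp hpt))) subset_union_left
  · have hpt' : p.1 ∉ openBall x t := fun h => hpt (openBall_subset_closedBall x t h)
    exact mem_of_superset (prod_mem_prod
      (compl_closedBall_mem_filter hr fun h => hpt' (closedBall_subset_openBall x hrt h))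
      (compl_closedBall_mem_filter hr fun h => hpt' (hp' h))) subset_union_right

end Filter

section FilterDense

variable {K : Type*} [DenselyNormedField K] [IsUltrametricDist K] {P : ProjTree K} {x : K} {r : ℝ}
  {D : Set (ProjTree K)}

theorem filter_of_neBot (S : KTree K) : (of S).filter.NeBot := by
  refine NeBot.mono ?_ (bind_filter_le_filter S)
  have hdense : ∃ᶠ T in 𝓝 S, T ∈ range ((↑) : BallTree K → KTree K) :=
    mem_closure_iff_frequently.1 (UniformSpace.Completion.denseRange_coe S)
  refine (frequently_true_iff_neBot _).1 (frequently_bind.2 (hdense.mono ?_))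
  rintro _ ⟨T, rfl⟩
  obtain ⟨⟨a, t⟩, rfl⟩ := Quotient.exists_rep T
  have := nearSphere_neBot a t.coe_nonneg
  exact (frequently_true_iff_neBot _).2 (NeBot.mono inferInstance (map_nearSphere_le_filter a t))

instance filter_neBot (P : ProjTree K) : P.filter.NeBot :=
  match P with
  | infty => NeBot.mono inferInstance pure_infty_le_filter
  | of S => filter_of_neBot S

theorem frequently_mem_closedBall (hr : 0 < r) (h : P ∈ closedBall x r) :
    ∃ᶠ p in P.filter, p ∈ P1.closedBall x r := by
  obtain ⟨S, hS : KTree.sup _ S ≤ r, rfl⟩ := h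
  rcases ((KTree.diam_le_sup_right (KTree.ofPoint x) S).trans hS).lt_or_eq with hd | hd
  · obtain ⟨a, ha⟩ := KTree.exists_sup_ofPoint_lt S hd
    refine Eventually.frequently ?_
    filter_upwards [openBall_mem_filter hr (of_mem_openBall.2 ha)]
    rintro _ ⟨z, hz, rfl⟩
    exact P1.of_mem_closedBall.2 ((norm_sub_le_max' z a x).trans (max_le (le_of_lt hz)
      ((KTree.norm_sub_le_max_sup a x S).trans (max_le ha.le hS))))
  · rw [KTree.eq_mk_of_sup_eq_diam ((hS.trans hd.ge).antisymm (KTree.diam_le_sup_right _ S)), hd]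
    refine Frequently.filter_mono ?_ (map_nearSphere_le_filter x _)
    rw [Real.coe_toNNReal _ hr.le, frequently_map]
    exact (frequently_norm_sub_lt_nearSphere x hr).mono fun z hz =>
      P1.of_mem_closedBall.2 hz.le

theorem frequently_notMem_openBall (hr : 0 < r) (h : P ∉ openBall x r) :
    ∃ᶠ p in P.filter, p ∉ P1.openBall x r := by
  by_cases hP : P ∈ closedBall x r
  · obtain ⟨S, hS : KTree.sup _ S ≤ r, rfl⟩ := hP
    rw [of_mem_openBall, not_lt] at h
    rcases ((KTree.diam_le_sup_right (KTree.ofPoint x) S).trans hS).lt_or_eq with hd | hd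
    · obtain ⟨a, ha⟩ := KTree.exists_sup_ofPoint_lt S hd
      refine Eventually.frequently ?_
      filter_upwards [openBall_mem_filter hr (of_mem_openBall.2 ha)]
      rintro _ ⟨z, hz, rfl⟩ hzx
      have hxa : ‖x - a‖ < r := (norm_sub_le_max' x z a).trans_lt
        (max_lt (norm_sub_rev x z ▸ P1.of_mem_openBall.1 hzx) hz)
      exact h.not_gt ((KTree.sup_ofPoint_le_max x a S).trans_lt (max_lt hxa ha))
    · rw [KTree.eq_mk_of_sup_eq_diam ((hS.antisymm h).trans hd.symm), hd]
      refine Frequently.filter_mono ?_ (map_nearSphere_le_filter x _)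
      rw [Real.coe_toNNReal _ hr.le, frequently_map]
      exact (frequently_lt_norm_sub_nearSphere x hr.le).mono fun z hz hz' =>
        (P1.of_mem_openBall.1 hz').not_gt hz
  · refine Eventually.frequently ?_
    filter_upwards [compl_closedBall_mem_filter hr hP] with p hp hpx
    exact hp (P1.openBall_subset_closedBall x r hpx)

theorem openBall_mem_filter_iff (hr : 0 < r) :
    P1.openBall x r ∈ P.filter ↔ P ∈ openBall x r :=
  ⟨fun h => by_contra fun hP => (frequently_notMem_openBall hr hP) (by simpa using h),
    openBall_mem_filter hr⟩

theorem compl_closedBall_mem_filter_iff (hr : 0 < r) :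
    (P1.closedBall x r)ᶜ ∈ P.filter ↔ P ∉ closedBall x r :=
  ⟨fun h hP => frequently_mem_closedBall hr hP h, compl_closedBall_mem_filter hr⟩

theorem trace_mem_filter_iff (hD : IsOpenBall D) : trace D ∈ P.filter ↔ P ∈ D := by
  rcases isOpenBall_iff.1 hD with ⟨x, r, hr, rfl⟩ | ⟨x, r, hr, rfl⟩
  · rw [trace_openBall, openBall_mem_filter_iff hr]
  · rw [trace_compl, trace_closedBall, compl_closedBall_mem_filter_iff hr, mem_compl_iff]

theorem frequently_mem_trace_iff (hD : IsClosedBall D) :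
    (∃ᶠ p in P.filter, p ∈ trace D) ↔ P ∈ D := by
  rw [← not_iff_not, not_frequently, ← mem_compl_iff,
    ← trace_mem_filter_iff (isClosedBall_iff_isOpenBall_compl.1 hD), trace_compl]
  rfl

theorem existsUnique_isOpenBall_trace_eq {B : Set (P1 K)}
    (hB : BerkLine.IsOpenBall B ∨ IsIrrationalBall B) : ∃! D, IsOpenBall D ∧ trace D = B := by
  obtain ⟨D, hD, rfl⟩ := exists_isOpenBall_trace_eq_iff.2 hB
  refine ⟨D, ⟨hD, rfl⟩, fun D' ⟨hD', h⟩ => Set.ext fun P => ?_⟩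
  rw [← trace_mem_filter_iff hD, ← h, trace_mem_filter_iff hD']

theorem existsUnique_isClosedBall_trace_eq {B : Set (P1 K)}
    (hB : BerkLine.IsClosedBall B ∨ IsIrrationalBall B) : ∃! D, IsClosedBall D ∧ trace D = B := by
  obtain ⟨D, hD, rfl⟩ := exists_isClosedBall_trace_eq_iff.2 hB
  refine ⟨D, ⟨hD, rfl⟩, fun D' ⟨hD', h⟩ => Set.ext fun P => ?_⟩
  rw [← frequently_mem_trace_iff hD, ← h, frequently_mem_trace_iff hD']

theorem filter_injective : Function.Injective (filter : ProjTree K → Filter (P1 K)) := by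
  intro P Q h
  have hball {x : K} {r : ℝ} (hr : 0 < r) : P ∈ openBall x r ↔ Q ∈ openBall x r := by
    rw [← openBall_mem_filter_iff hr, h, openBall_mem_filter_iff hr]
  have hmem (S : KTree K) : ∃ r, 0 < r ∧ of S ∈ openBall 0 r :=
    ⟨_, add_pos_of_nonneg_of_pos (sup_nonneg _ _) one_pos, of_mem_openBall.2 (lt_add_one _)⟩
  cases P with
  | infty =>
    cases Q with
    | infty => rfl
    | of T =>
      obtain ⟨r, hr, hT⟩ := hmem T
      exact absurd ((hball hr).2 hT) infty_notMem_openBall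
  | of S =>
    cases Q with
    | infty =>
      obtain ⟨r, hr, hS⟩ := hmem S
      exact absurd ((hball hr).1 hS) infty_notMem_openBall
    | of T =>
      refine congrArg of (KTree.ext_sup fun x => eq_of_forall_gt_iff fun r => ?_)
      rcases lt_or_ge 0 r with hr | hr
      · rw [← of_mem_openBall, hball hr, of_mem_openBall]
      · exact iff_of_false (hr.trans (sup_nonneg _ _)).not_gt (hr.trans (sup_nonneg _ _)).not_gt

end FilterDense

/-! ### Minimal Cauchy filters -/

section Compactification

variable {K : Type*} [DenselyNormedField K] [IsUltrametricDist K] [Infinite (ResField K)]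

theorem cauchy_filter (P : ProjTree K) : Cauchy P.filter := by
  refine P1.cauchy_iff.2 ⟨inferInstance, fun x r s hr hrs => ?_⟩
  by_cases hP : P ∈ closedBall x r
  · exact Or.inl (openBall_mem_filter (hr.trans hrs) (closedBall_subset_openBall x hrs hP))
  · exact Or.inr (compl_closedBall_mem_filter hr hP)

theorem filter_eq_of_filter_le {P : ProjTree K} {G : Filter (P1 K)} (hG : Cauchy G)
    (h : P.filter ≤ G) : G = P.filter := by
  have hG' := (P1.cauchy_iff.1 hG).2
  refine le_antisymm (le_filter_iff.2 ⟨fun x r _ hP => ?_, fun x r hr hP => ?_⟩) h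
  · obtain ⟨s, hs, hsr, hPs⟩ := exists_lt_mem_closedBall hP
    exact (hG' x s r hs hsr).resolve_right fun hc =>
      (compl_closedBall_mem_filter_iff hs).1 (h hc) hPs
  · obtain ⟨s, hrs, hPs⟩ := exists_gt_notMem_openBall hP
    exact (hG' x r s hr hrs).resolve_left fun ho =>
      hPs ((openBall_mem_filter_iff (hr.trans hrs)).1 (h ho))

/-- The map `ι` from the projective tree to the compactification of the projective line. -/
def toBer (P : ProjTree K) : Ber K :=
  ⟨⟨P.filter, cauchy_filter P⟩, fun _ hG h => filter_eq_of_filter_le hG h⟩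

theorem exists_le_filter_of_openBall_mem {F : Filter (P1 K)} (hF : Cauchy F)
    (h : ∃ x r, 0 < r ∧ P1.openBall x r ∈ F) : ∃ S : KTree K, F ≤ (of S).filter := by
  obtain ⟨hne, hFball⟩ := P1.cauchy_iff.1 hF
  let C : Set (BallTree K) := {T | ∃ x, ∃ r : ℝ≥0, P1.openBall x r ∈ F ∧ T = BallTree.mk x r}
  have hmem {x : K} {r : ℝ} (hr : 0 < r) (hx : P1.openBall x r ∈ F) :
      BallTree.mk x r.toNNReal ∈ C := ⟨x, _, by rwa [Real.coe_toNNReal _ hr.le], rfl⟩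
  obtain ⟨x₀, r₀, hr₀, hx₀⟩ := h
  obtain ⟨S, hS⟩ := KTree.exists_forall_isGLB_sup (C := C) ⟨_, hmem hr₀ hx₀⟩ (by
    rintro _ ⟨x, r, hx, rfl⟩ _ ⟨y, s, hy, rfl⟩
    exact BallTree.sup_mk_mk_of_openBall_mem hx hy)
  refine ⟨S, le_filter_iff.2 ⟨fun y s _ hys => ?_, fun y s hs hys => ?_⟩⟩
  · obtain ⟨_, ⟨_, ⟨x, r, hx, rfl⟩, rfl⟩, hxs⟩ := (isGLB_lt_iff (hS _)).1 (of_mem_openBall.1 hys)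
    simp only [KTree.sup_ofPoint_mk, max_lt_iff, norm_sub_rev y] at hxs
    exact mem_of_superset hx ((P1.openBall_subset_openBall x hxs.1.le).trans
      (P1.openBall_subset_openBall_of_norm_sub_lt hxs.2))
  · rw [of_mem_closedBall, not_le] at hys
    obtain ⟨t, hst, htS⟩ := exists_between hys
    refine (hFball y s t hs hst).resolve_left fun ht => ?_
    have hle := (hS (KTree.ofPoint y)).1 (mem_image_of_mem _ (hmem (hs.trans hst) ht))
    rw [KTree.sup_ofPoint_mk, sub_self, norm_zero, max_eq_left NNReal.zero_le_coe,
      Real.coe_toNNReal _ (hs.trans hst).le] at hle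
    exact hle.not_gt htS

theorem exists_le_filter {F : Filter (P1 K)} (hF : Cauchy F) : ∃ P : ProjTree K, F ≤ P.filter := by
  by_cases h : ∃ x r, 0 < r ∧ P1.openBall x r ∈ F
  · obtain ⟨S, hS⟩ := exists_le_filter_of_openBall_mem hF h
    exact ⟨of S, hS⟩
  · push Not at h
    refine ⟨infty, le_filter_iff.2 ⟨fun _ _ _ h => absurd h infty_notMem_openBall,
      fun x r hr _ => ?_⟩⟩
    exact ((P1.cauchy_iff.1 hF).2 x r (r + 1) hr (lt_add_one r)).resolve_left
      (h x _ (add_pos hr one_pos))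

end Compactification

end ProjTree

namespace Ber

variable {K : Type*} [DenselyNormedField K] [IsUltrametricDist K] [Infinite (ResField K)]

theorem ext_filter {F G : Ber K} (h : F.filter = G.filter) : F = G := Subtype.ext (Subtype.ext h)

theorem cauchy (F : Ber K) : Cauchy F.filter := F.1.2

theorem eq_filter_of_filter_le (F : Ber K) {G : Filter (P1 K)} (hG : Cauchy G)
    (h : F.filter ≤ G) : G = F.filter :=
  F.2 G hG h

theorem mem_uniformity {V : Set (Ber K × Ber K)} : V ∈ 𝓤 (Ber K) ↔
    ∃ W ∈ 𝓤 (P1 K), {p : Ber K × Ber K | W ∈ p.1.filter ×ˢ p.2.filter} ⊆ V := by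
  have h : 𝓤 (Ber K) = comap (fun p : Ber K × Ber K => (p.1.1, p.2.1)) (𝓤 (CauchyFilter (P1 K))) :=
    uniformity_comap _
  rw [h, mem_comap]
  constructor
  · rintro ⟨U, hU, hUV⟩
    obtain ⟨W, hW, hWU⟩ := CauchyFilter.mem_uniformity.1 hU
    exact ⟨W, hW, fun p hp => hUV (hWU hp)⟩
  · rintro ⟨W, hW, hWV⟩
    exact ⟨_, CauchyFilter.mem_uniformity.2 ⟨W, hW, Subset.rfl⟩, hWV⟩

theorem comap_toBer_uniformity_le :
    comap (fun p : P1 K × P1 K => (P1.toBer p.1, P1.toBer p.2)) (𝓤 (Ber K)) ≤ 𝓤 (P1 K) := by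
  refine fun W hW => ⟨_, mem_uniformity.2 ⟨W, hW, Subset.rfl⟩, fun p hp => ?_⟩
  have hp' : W ∈ 𝓝 p := nhds_prod_eq (x := p.1) (y := p.2) ▸ hp
  exact mem_of_mem_nhds hp'

theorem tendsto_toBer (F : Ber K) : Tendsto P1.toBer F.filter (𝓝 F) := by
  intro U hU
  obtain ⟨V, hV, hVU⟩ := UniformSpace.mem_nhds_iff.1 hU
  obtain ⟨W, hW, hWV⟩ := mem_uniformity.1 hV
  obtain ⟨W', hW', hWW'⟩ := comp_mem_uniformity_sets hW
  obtain ⟨A, hA, hAW'⟩ := (cauchy_iff.1 F.cauchy).2 W' hW'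
  refine mem_map.2 (mem_of_superset hA fun y hy => hVU (hWV ?_))
  refine mem_of_superset (prod_mem_prod hA (UniformSpace.ball_mem_nhds y hW')) ?_
  exact fun p ⟨hp, hyp⟩ => hWW' ⟨y, hAW' (mk_mem_prod hp hy), hyp⟩

theorem comap_toBer_nhds (F : Ber K) : comap P1.toBer (𝓝 F) = F.filter := by
  have hle := map_le_iff_le_comap.1 (tendsto_toBer F)
  have := NeBot.mono F.cauchy.1 hle
  exact F.eq_filter_of_filter_le (cauchy_nhds.comap comap_toBer_uniformity_le) hle

theorem mem_cl_iff {F : Ber K} {Y : Set (P1 K)} : F ∈ cl Y ↔ ∃ᶠ p in F.filter, p ∈ Y := by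
  rw [cl, mem_closure_iff_frequently, ← comap_toBer_nhds, frequently_comap]
  simp only [mem_image, and_comm]

end Ber

namespace ProjTree

section ToBer

variable {K : Type*} [DenselyNormedField K] [IsUltrametricDist K] [Infinite (ResField K)]
  {D : Set (ProjTree K)}

theorem toBer_injective : Function.Injective (toBer : ProjTree K → Ber K) :=
  fun _ _ h => filter_injective (congrArg Ber.filter h)

theorem toBer_surjective : Function.Surjective (toBer : ProjTree K → Ber K) := by
  intro F
  obtain ⟨P, hP⟩ := exists_le_filter F.cauchy
  exact ⟨P, Ber.ext_filter (F.eq_filter_of_filter_le (cauchy_filter P) hP)⟩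

theorem bind_prod_filter_le_uniformity :
    ((𝓤 (ProjTree K)).bind fun p => p.1.filter ×ˢ p.2.filter) ≤ 𝓤 (P1 K) := by
  simp only [P1.uniformity_eq_iInf, le_iInf_iff, le_principal_iff]
  exact fun x r s hr hrs => mem_bind'.2 (eventually_coverRel_mem_prod_filter x hr hrs)

theorem uniformContinuous_toBer : UniformContinuous (toBer : ProjTree K → Ber K) := by
  intro V hV
  obtain ⟨W, hW, hWV⟩ := Ber.mem_uniformity.1 hV
  exact mem_of_superset (mem_bind'.1 (bind_prod_filter_le_uniformity hW)) fun p hp => hWV hp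

theorem image_toBer_of_isOpenBall (hD : IsOpenBall D) : toBer '' D = Ber.hat (trace D) := by
  ext F
  obtain ⟨P, rfl⟩ := toBer_surjective F
  rw [toBer_injective.mem_set_image]
  exact (trace_mem_filter_iff hD).symm

theorem image_toBer_of_isClosedBall (hD : IsClosedBall D) : toBer '' D = Ber.cl (trace D) := by
  ext F
  obtain ⟨P, rfl⟩ := toBer_surjective F
  rw [toBer_injective.mem_set_image, Ber.mem_cl_iff]
  exact (frequently_mem_trace_iff hD).symm

theorem ball_toBer_of (S : KTree K) :
    (of S).toBer.ball = {w | KTree.sup (KTree.ofPoint w) S ≤ KTree.diam S} := by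
  ext w
  constructor
  · intro hw
    change KTree.sup _ S ≤ _
    refine le_of_forall_gt fun r hr => ?_
    obtain ⟨a, ha⟩ := KTree.exists_sup_ofPoint_lt S hr
    have hr₀ : 0 < r := (KTree.diam_nonneg S).trans_lt hr
    have hwa : ‖w - a‖ < r := hw {z | ‖z - a‖ < r}
      ⟨isBallK_setOf_norm_sub_lt a hr₀, openBall_mem_filter hr₀ (of_mem_openBall.2 ha)⟩
    exact (KTree.sup_ofPoint_le_max w a S).trans_lt (max_lt hwa ha)
  · rintro (hw : KTree.sup _ S ≤ _) B ⟨hB, hBS⟩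
    have hle (x : K) : ‖w - x‖ ≤ KTree.sup (KTree.ofPoint x) S :=
      (KTree.norm_sub_le_max_sup w x S).trans
        (max_le (hw.trans (KTree.diam_le_sup_right _ S)) le_rfl)
    have hclosed {x : K} {r : ℝ} (hr : 0 < r) (h : P1.closedBall x r ∈ (of S).filter) :
        ‖w - x‖ ≤ r := by
      refine (hle x).trans (of_mem_closedBall.1 (by_contra fun hS => ?_))
      exact compl_notMem h (compl_closedBall_mem_filter hr hS)
    rcases hB with ⟨x, r, hr, rfl⟩ | ⟨x, r, hr, rfl⟩ | ⟨x, r, hr, -, rfl⟩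
    · exact (hle x).trans_lt (of_mem_openBall.1
        ((openBall_mem_filter_iff (pos_of_mem_valueGroup hr)).1 hBS))
    · exact hclosed (pos_of_mem_valueGroup hr) hBS
    · exact hclosed hr hBS

theorem ball_toBer_infty : (infty : ProjTree K).toBer.ball = univ :=
  eq_univ_of_forall fun _ _ ⟨_, hB⟩ => absurd (pure_infty_le_filter hB) infty_notMem_image

theorem ball_toBer_ofBall_mk (a : K) (r : ℝ≥0) :
    (ofBall (BallTree.mk a r)).toBer.ball = {w | ‖w - a‖ ≤ r} := by
  rw [ofBall, ball_toBer_of]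
  simp only [KTree.sup_ofPoint_mk, KTree.diam_mk, max_le_iff, le_refl, true_and]

theorem ball_toBer_ofBall (S : BallTree K) : (ofBall S).toBer.ball = S.ball := by
  obtain ⟨⟨a, r⟩, rfl⟩ := Quotient.exists_rep S
  refine (ball_toBer_ofBall_mk a r).trans ?_
  simp only [← dist_eq_norm]
  rfl

theorem eq_ofBall_mk_of_ball_toBer_eq {P : ProjTree K} {a : K} {r : ℝ≥0} (hr : 0 < r)
    (h : P.toBer.ball = {w | ‖w - a‖ ≤ r}) : P = ofBall (BallTree.mk a r) := by
  cases P with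
  | infty =>
    obtain ⟨z, hz⟩ := NormedField.exists_lt_norm K r
    have haz : a + z ∈ {w : K | ‖w - a‖ ≤ r} := h ▸ ball_toBer_infty.ge (mem_univ _)
    rw [mem_ofPred_eq, add_sub_cancel_left] at haz
    exact absurd haz hz.not_ge
  | of S =>
    have ha : a ∈ (of S).toBer.ball := by simp [h]
    rw [ball_toBer_of] at ha
    obtain ⟨t, rfl⟩ : ∃ t : ℝ≥0, S = (BallTree.mk a t : KTree K) :=
      ⟨_, KTree.eq_mk_of_sup_eq_diam (le_antisymm ha (KTree.diam_le_sup_right _ S))⟩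
    rw [← ofBall, ball_toBer_ofBall_mk] at h
    have hrt : (r : ℝ) ≤ t := le_of_closedBall_subset (NNReal.coe_pos.2 hr) h.ge
    have htr : (t : ℝ) ≤ r := le_of_closedBall_subset ((NNReal.coe_pos.2 hr).trans_le hrt) h.le
    rw [NNReal.coe_injective (htr.antisymm hrt), ofBall]

theorem existsUnique_ball_eq {S : BallTree K} (hS : S ∉ range BallTree.ofPoint) :
    ∃! F : Ber K, F.ball = S.ball := by
  refine ⟨_, ball_toBer_ofBall S, fun F hF => ?_⟩
  obtain ⟨P, rfl⟩ := toBer_surjective F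
  obtain ⟨⟨a, r⟩, rfl⟩ := Quotient.exists_rep S
  have hr : 0 < r := pos_iff_ne_zero.2 fun h => hS ⟨a, h ▸ rfl⟩
  exact congrArg toBer (eq_ofBall_mk_of_ball_toBer_eq hr
    (hF.trans ((ball_toBer_ofBall _).symm.trans (ball_toBer_ofBall_mk a r))))

end ToBer

end ProjTree

end BerkLine

end

theorem mainTheorem1_general {K : Type*} [DenselyNormedField K] [IsUltrametricDist K]
    [Infinite (ResField K)] :
    (∀ S : BallTree K, S ∉ Set.range BallTree.ofPoint → ∃! F : Ber K, F.ball = S.ball) ∧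
    ∃ ι : ProjTree K → Ber K,
      (∀ S : BallTree K, S ∉ Set.range BallTree.ofPoint →
        (ι (ProjTree.ofBall S)).ball = S.ball) ∧
      Function.Bijective ι ∧ UniformContinuous ι ∧
      (∀ B : Set (P1 K), IsOpenBall B ∨ IsIrrationalBall B →
        ∃! D : Set (ProjTree K), ProjTree.IsOpenBall D ∧ ProjTree.trace D = B) ∧
      (∀ D : Set (ProjTree K), ProjTree.IsOpenBall D →
        (IsOpenBall (ProjTree.trace D) ∨ IsIrrationalBall (ProjTree.trace D)) ∧
          ι '' D = Ber.hat (ProjTree.trace D)) ∧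
      (∀ B : Set (P1 K), IsClosedBall B ∨ IsIrrationalBall B →
        ∃! D : Set (ProjTree K), ProjTree.IsClosedBall D ∧ ProjTree.trace D = B) ∧
      (∀ D : Set (ProjTree K), ProjTree.IsClosedBall D →
        (IsClosedBall (ProjTree.trace D) ∨ IsIrrationalBall (ProjTree.trace D)) ∧
          ι '' D = Ber.cl (ProjTree.trace D)) :=
  ⟨fun _ hS => ProjTree.existsUnique_ball_eq hS,
    ProjTree.toBer,
    fun S _ => ProjTree.ball_toBer_ofBall S,
    ⟨ProjTree.toBer_injective, ProjTree.toBer_surjective⟩,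
    ProjTree.uniformContinuous_toBer,
    fun _ hB => ProjTree.existsUnique_isOpenBall_trace_eq hB,
    fun D hD => ⟨ProjTree.exists_isOpenBall_trace_eq_iff.1 ⟨D, hD, rfl⟩,
      ProjTree.image_toBer_of_isOpenBall hD⟩,
    fun _ hB => ProjTree.existsUnique_isClosedBall_trace_eq hB,
    fun D hD => ⟨ProjTree.exists_isClosedBall_trace_eq_iff.1 ⟨D, hD, rfl⟩,
      ProjTree.image_toBer_of_isClosedBall hD⟩⟩

theorem mainTheorem1 {K : Type*} [DenselyNormedField K] [IsUltrametricDist K]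
    [CompleteSpace K] [Infinite (ResField K)] :
    (∀ S : BallTree K, S ∉ Set.range BallTree.ofPoint → ∃! F : Ber K, F.ball = S.ball) ∧
    ∃ ι : ProjTree K → Ber K,
      (∀ S : BallTree K, S ∉ Set.range BallTree.ofPoint →
        (ι (ProjTree.ofBall S)).ball = S.ball) ∧
      Function.Bijective ι ∧ UniformContinuous ι ∧
      (∀ B : Set (P1 K), IsOpenBall B ∨ IsIrrationalBall B →
        ∃! D : Set (ProjTree K), ProjTree.IsOpenBall D ∧ ProjTree.trace D = B) ∧
      (∀ D : Set (ProjTree K), ProjTree.IsOpenBall D →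
        (IsOpenBall (ProjTree.trace D) ∨ IsIrrationalBall (ProjTree.trace D)) ∧
          ι '' D = Ber.hat (ProjTree.trace D)) ∧
      (∀ B : Set (P1 K), IsClosedBall B ∨ IsIrrationalBall B →
        ∃! D : Set (ProjTree K), ProjTree.IsClosedBall D ∧ ProjTree.trace D = B) ∧
      (∀ D : Set (ProjTree K), ProjTree.IsClosedBall D →
        (IsClosedBall (ProjTree.trace D) ∨ IsIrrationalBall (ProjTree.trace D)) ∧
          ι '' D = Ber.cl (ProjTree.trace D)) := mainTheorem1_general
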